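/- Fix integers $d,N\ge 1$ and put $\hbar=N^{-1/d}$. On functions on $\mathbb R^d$ use the Fourier transform $\widehat f(\xi)=(2\pi)^{-d}\int e^{-i\xi\cdot x}f(x)\,dx$, extended to tempered distributions by duality. Let $V:\mathbb R^d\to\mathbb R$ be regular: its Fourier transform is a function $\widehat V$ with $\widehat V\ge 0$ almost everywhere and $$\|V\|:=\int_{\mathbb R^d}\widehat V(\xi)(1+|\xi|)\,d\xi<\infty .$$ Let $f_1,\dots,f_M\in L^2(\mathbb R^d)$ be orthonormal ($M\ge 0$), and set $\gamma=\sum_{i}|f_i\rangle\langle f_i|$, $u=\mathbf 1-\gamma$, $v=\sum_i|\overline{f_i}\rangle\langle f_i|$. Let $\mathscr F$ be the fermionic Fock space over $L^2(\mathbb R^d)$, with annihilation operators $a(g)$ and number operator $\mathcal N$. With $u_x(y)=u(y,x)$ and $v_x(y)=v(y,x)$, let $\alpha_x=a(u_x)$ and $\beta_x=a(\overline{v_x})$, and let $$\mathcal L_4^{\rm diag}=\int\!\!\int V(x-y)\big(\alpha_x^*\alpha_y^*\alpha_y\alpha_x+\beta_x^*\beta_y^*\beta_y\beta_x-2\alpha_x^*\beta_y^*\beta_y\alpha_x\big)\,dx\,dy+2\int\!\!\int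 V(x-y)\,\alpha_x^*\beta_x^*\beta_y\alpha_y\,dx\,dy .$$ Let $e_\xi$ denote multiplication by $e^{i\xi\cdot x}$, and suppose that for some $C_0>0$ $$\|[e_\xi,\gamma]\|\le C_0\,|\xi|\,N\hbar\qquad\text{for all }\xi\in\mathbb R^d$$ (operator norm), and that $20\,C_0N\hbar\ge 1$ (since $N\hbar\ge1$, this holds in particular whenever $C_0\ge 1/20$). Then the quadratic form of $\mathcal L_4^{\rm diag}$ is well defined and real on the domain of $\mathcal N$, and $$N^{-1}\mathcal L_4^{\rm diag}\ \ge\ -20\,C_0\,\|V\|\,\hbar\,(\mathcal N+\mathbf 1)$$ there in the sense of quadratic forms: $N^{-1}\langle\Psi,\mathcal L_4^{\rm diag}\Psi\rangle\ge-20\,C_0\|V\|\hbar\,\big(\langle\Psi,\mathcal N\Psi\rangle+\|\Psi\|^2\big)$ for all $\Psi$ in the domain of $\mathcal N$. -/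

import Mathlib

open MeasureTheory Complex
open scoped ComplexConjugate SchwartzMap ENNReal

noncomputable section

namespace FermiDiag

/-- The one-particle configuration space `ℝ^d`. -/
abbrev Space (d : ℕ) := EuclideanSpace ℝ (Fin d)

/-- The one-particle Hilbert space `L²(ℝ^d)`. -/
abbrev OneParticle (d : ℕ) := Lp ℂ 2 (volume : Measure (Space d))

/-- `L²((ℝ^d)^n)`. For `n = 0` this is `L²` of a one-point space of mass one, that is `ℂ`. -/
abbrev NParticle (d n : ℕ) := Lp ℂ 2 (volume : Measure (Fin n → Space d))

/-- The semi-classical parameter `ħ = N^{-1/d}`. -/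
def hbar (d N : ℕ) : ℝ := (N : ℝ) ^ (-(1 : ℝ) / (d : ℝ))

/-! ### Pair potentials -/

/-- The Fourier transform `(2π)^{-d} ∫ e^{-i x·ξ} φ(ξ) dξ` of a function `φ`. -/
def fourierTr {d : ℕ} (φ : Space d → ℂ) (x : Space d) : ℂ :=
  ((2 * Real.pi) ^ d : ℝ)⁻¹ * ∫ ξ, cexp (-(I * (inner ℝ x ξ : ℝ))) * φ ξ

/-- `Vhat` is the Fourier transform of `V` in the sense of tempered distributions:
`∫ V φ̂ = ∫ Vhat φ` for all Schwartz functions `φ`. -/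
def IsFourierTransform {d : ℕ} (V Vhat : Space d → ℝ) : Prop :=
  ∀ φ : 𝓢(Space d, ℂ),
    Integrable (fun x => (V x : ℂ) * fourierTr φ x) ∧
    Integrable (fun ξ => (Vhat ξ : ℂ) * φ ξ) ∧
    ∫ x, (V x : ℂ) * fourierTr φ x = ∫ ξ, (Vhat ξ : ℂ) * φ ξ

/-- `V` is a regular potential with Fourier transform `Vhat`:
`Vhat ≥ 0` and `∫ Vhat(ξ) (1 + |ξ|) dξ < ∞`. -/
structure IsRegularPotential {d : ℕ} (V Vhat : Space d → ℝ) : Prop where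
  fourier : IsFourierTransform V Vhat
  nonneg : ∀ᵐ ξ, 0 ≤ Vhat ξ
  integrable : Integrable (fun ξ => Vhat ξ * (1 + ‖ξ‖))

/-- `‖V‖ = ∫ Vhat(ξ) (1 + |ξ|) dξ`. -/
def potentialNorm {d : ℕ} (Vhat : Space d → ℝ) : ℝ := ∫ ξ, Vhat ξ * (1 + ‖ξ‖)

/-! ### Fermionic Fock space -/

/-- Permuting the variables preserves the measure on `(ℝ^d)^n`. -/
theorem measurePreserving_perm (d n : ℕ) (σ : Equiv.Perm (Fin n)) :
    MeasurePreserving (fun (X : Fin n → Space d) (i : Fin n) => X (σ i)) volume volume := by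
  have h := volume_measurePreserving_piCongrLeft (fun _ : Fin n => Space d) σ.symm
  convert h using 1
  funext X i
  have := MeasurableEquiv.piCongrLeft_apply_apply (β := fun _ : Fin n => Space d)
    σ.symm X (σ i)
  simpa using this.symm

/-- The `n`-particle sector: the `Ψ ∈ L²((ℝ^d)^n)` with
`Ψ(x_{σ(1)}, …, x_{σ(n)}) = sgn(σ) Ψ(x_1, …, x_n)` almost everywhere, for all `σ`. -/
def antisym (d n : ℕ) : Submodule ℂ (NParticle d n) :=
  ⨅ σ : Equiv.Perm (Fin n), LinearMap.ker
    ((Lp.compMeasurePreservingₗ ℂ _ (measurePreserving_perm d n σ) :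
        NParticle d n →ₗ[ℂ] NParticle d n)
      - ((Equiv.Perm.sign σ : ℤ) : ℂ) • (LinearMap.id : NParticle d n →ₗ[ℂ] NParticle d n))

/-- Fermionic Fock space, the Hilbert direct sum of the `n`-particle sectors. -/
abbrev FockSpace (d : ℕ) := lp (fun n : ℕ => antisym d n) 2

/-- A function representing the `n`-particle component of `Ψ`. -/
def wave {d : ℕ} (Ψ : FockSpace d) (n : ℕ) : (Fin n → Space d) → ℂ :=
  ((Ψ n : NParticle d n) : (Fin n → Space d) → ℂ)

/-- The domain of the number operator `𝒩`. -/
def InNumberDomain {d : ℕ} (Ψ : FockSpace d) : Prop :=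
  Summable fun n : ℕ => (n : ℝ) ^ 2 * ‖Ψ n‖ ^ 2

/-- The quadratic form `⟨Ψ, 𝒩 Ψ⟩`. -/
def numberForm {d : ℕ} (Ψ : FockSpace d) : ℝ := ∑' n : ℕ, (n : ℝ) * ‖Ψ n‖ ^ 2

/-! ### Annihilation operators -/

/-- The operator-valued distribution `a_x`, from `n + 1` to `n` particles. -/
def annAt {d n : ℕ} (x : Space d) (Φ : (Fin (n + 1) → Space d) → ℂ) :
    (Fin n → Space d) → ℂ :=
  fun X => (Real.sqrt (n + 1) : ℂ) * Φ (Fin.cons x X)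

/-- The annihilation operator `a(g)`, from `n + 1` to `n` particles. -/
def ann {d n : ℕ} (g : Space d → ℂ) (Φ : (Fin (n + 1) → Space d) → ℂ) :
    (Fin n → Space d) → ℂ :=
  fun X => (Real.sqrt (n + 1) : ℂ) * ∫ y, conj (g y) * Φ (Fin.cons y X)

/-! ### The reference density matrix -/

/-- The density matrix `γ = ∑ᵢ |fᵢ⟩⟨fᵢ|`. -/
def densityOp {d M : ℕ} (f : Fin M → OneParticle d) : OneParticle d →L[ℂ] OneParticle d :=
  ∑ i, InnerProductSpace.rankOne ℂ (f i) (f i)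

/-- The kernel `γ(x,y) = ∑ᵢ fᵢ(x) conj (fᵢ(y))`. -/
def gammaKernel {d M : ℕ} (f : Fin M → OneParticle d) (x y : Space d) : ℂ :=
  ∑ i, f i x * conj (f i y)

/-- The kernel of `v = ∑ᵢ |conj fᵢ⟩⟨fᵢ|`, that is `v(x,y) = ∑ᵢ conj (fᵢ(x)) conj (fᵢ(y))`. -/
def vKernel {d M : ℕ} (f : Fin M → OneParticle d) (x y : Space d) : ℂ :=
  ∑ i, conj (f i x) * conj (f i y)

/-- `α_x = a(u_x)` with `u_x(y) = u(y,x)` and `u = 1 - γ`. The identity has the kernel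
`δ(y - x)`, so that `α_x = a_x - a(γ_x)` with `γ_x(y) = γ(y,x)`. -/
def alpha {d M n : ℕ} (f : Fin M → OneParticle d) (x : Space d)
    (Φ : (Fin (n + 1) → Space d) → ℂ) : (Fin n → Space d) → ℂ :=
  fun X => annAt x Φ X - ann (fun y => gammaKernel f y x) Φ X

/-- `β_x = a(conj v_x)` with `v_x(y) = v(y,x)`. -/
def beta {d M n : ℕ} (f : Fin M → OneParticle d) (x : Space d)
    (Φ : (Fin (n + 1) → Space d) → ℂ) : (Fin n → Space d) → ℂ :=
  ann (fun y => conj (vKernel f y x)) Φ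

/-- The operator of multiplication by `e_ξ(x) = e^{i ξ·x}` on `L²(ℝ^d)`. -/
def expMul {d : ℕ} (ξ : Space d) : OneParticle d →L[ℂ] OneParticle d :=
  (ContinuousLinearMap.mul ℂ ℂ).holderL volume ∞ 2 2
    (MemLp.toLp (fun x : Space d => cexp (I * (inner ℝ ξ x : ℝ)))
      (memLp_top_of_bound (by fun_prop) 1
        (Filter.Eventually.of_forall fun x => by
          rw [mul_comm, Complex.norm_exp_ofReal_mul_I])))

/-! ### The diagonal quartic term -/

/-- The `L²` inner product of two functions on `(ℝ^d)^n`, antilinear in the first one. -/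
def braket {d n : ℕ} (Φ₁ Φ₂ : (Fin n → Space d) → ℂ) : ℂ := ∫ X, conj (Φ₁ X) * Φ₂ X

/-- The integrand, at `p = (x,y)`, of `⟨Φ, 𝓛₄^diag Φ⟩` for `Φ` with `n + 2` particles:
`V(x-y) ⟨Φ, (α*_x α*_y α_y α_x + β*_x β*_y β_y β_x - 2 α*_x β*_y β_y α_x) Φ⟩
  + 2 V(x-y) ⟨Φ, α*_x β*_x β_y α_y Φ⟩`. -/
def diagIntegrand {d M n : ℕ} (V : Space d → ℝ) (f : Fin M → OneParticle d)
    (Φ : (Fin (n + 2) → Space d) → ℂ) (p : Space d × Space d) : ℂ :=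
  (V (p.1 - p.2) : ℂ) *
      (braket (alpha f p.2 (alpha f p.1 Φ)) (alpha f p.2 (alpha f p.1 Φ))
        + braket (beta f p.2 (beta f p.1 Φ)) (beta f p.2 (beta f p.1 Φ))
        - 2 * braket (beta f p.2 (alpha f p.1 Φ)) (beta f p.2 (alpha f p.1 Φ)))
    + 2 * ((V (p.1 - p.2) : ℂ) *
      braket (beta f p.1 (alpha f p.1 Φ)) (beta f p.2 (alpha f p.2 Φ)))

/-- `⟨Φ, 𝓛₄^diag Φ⟩` for `Φ` with `n + 2` particles. -/
def diagSector {d M n : ℕ} (V : Space d → ℝ) (f : Fin M → OneParticle d)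
    (Φ : (Fin (n + 2) → Space d) → ℂ) : ℂ :=
  ∫ p : Space d × Space d, diagIntegrand V f Φ p

/-- The quadratic form `⟨Ψ, 𝓛₄^diag Ψ⟩` on Fock space. The operator preserves the particle
number, and vanishes on the sectors with fewer than two particles. -/
def diagForm {d M : ℕ} (V : Space d → ℝ) (f : Fin M → OneParticle d) (Ψ : FockSpace d) : ℂ :=
  ∑' n : ℕ, diagSector V f (wave Ψ (n + 2))

end FermiDiag

end

open MeasureTheory Complex
open scoped ComplexConjugate SchwartzMap ENNReal

noncomputable section

namespace FermiDiag

/-! The pair potential is a superposition `V(x - y) = ∫ Vhat(ξ) e^{iξ·(x - y)} dξ` with `Vhat ≥ 0`,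
so it suffices to bound the form from below at each fixed frequency `ξ`. On the sector with `m = n +
2` particles two annihilation operators contribute `√(m(m - 1))`, while `α_x` and `β_x` turn into
the bounded operators `u` and `v` acting on one variable.

Let `D = u e u - v* e v` with `e = e_{-ξ}`, and write `Dᵢ` for `D` in the `i`-th variable. The real
part of the first three terms at frequency `ξ` is `m(m - 1) Re ⟨D₁Φ, D₂Φ⟩`. For antisymmetric `Φ`
this equals `‖∑ᵢ DᵢΦ‖² - m ‖D₁Φ‖²`, hence is at least `-m ‖D₁Φ‖²` (`ActsAs.pair_nonneg`). Because `v
u = 0` and `u + v* v = 1`, the two parts of `D` are orthogonal and `‖D‖ ≤ 1` (`norm_diffOp_le`),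
which leaves the error `-m ‖Φ‖²` (`pair_terms_lower_bound`). The fourth term is a squared norm
(`cross_term_eq_norm_sq`) and can be dropped.

Integration against `Vhat` gives `𝓛₄^diag ≥ -(∫ Vhat) 𝒩` on every sector (`diagSector_re_ge`). The
theorem follows from `∫ Vhat ≤ ‖V‖` and `1 ≤ 20 C₀ N ħ`.

Two points need care. The potential is given only through a distributional Fourier transform, so it
must be identified almost everywhere with the inverse Fourier integral
(`IsRegularPotential.ae_eq_invFourier`). And `α_x`, `β_x` are defined pointwise on representatives,
so they must be matched almost everywhere with operators on `L²` (`ae_alpha_family`,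
`ae_beta_family`, `ae_beta_family_diag`). Identities between those operators are reduced to
one-particle identities by the totality of the vectors `g ⊗ χ` (`ext_tensor`). -/

/-! ### Regular potentials as inverse Fourier integrals -/

open FourierTransform in
/-- `fourierTr` in terms of Mathlib's Fourier transform. -/
theorem fourierTr_eq_fourier {d : ℕ} (φ : Space d → ℂ) (x : Space d) :
    fourierTr φ x = (((2 * Real.pi) ^ d : ℝ) : ℂ)⁻¹ * 𝓕 φ ((2 * Real.pi)⁻¹ • x) := by
  rw [fourierTr, Real.fourier_eq' φ]
  rw [Complex.ofReal_inv]
  congr 1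
  refine integral_congr_ae (Filter.Eventually.of_forall fun ξ => ?_)
  simp only [smul_eq_mul, real_inner_smul_right, real_inner_comm ξ x]
  congr 2
  push_cast
  field_simp

theorem IsRegularPotential.integrable_vhat {d : ℕ} {V Vhat : Space d → ℝ}
    (hV : IsRegularPotential V Vhat) : Integrable Vhat := by
  have h : Integrable (fun ξ => (1 + ‖ξ‖)⁻¹ * (Vhat ξ * (1 + ‖ξ‖))) := by
    refine hV.integrable.bdd_mul (c := 1) ?_ (Filter.Eventually.of_forall fun ξ => ?_)
    · exact ((measurable_const.add measurable_norm).inv).aestronglyMeasurable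
    · rw [norm_inv, Real.norm_of_nonneg (by positivity)]
      exact inv_le_one_of_one_le₀ (by linarith [norm_nonneg ξ])
  refine h.congr (Filter.Eventually.of_forall fun ξ => ?_)
  have : (1 + ‖ξ‖) ≠ 0 := by positivity
  simp only
  field_simp

theorem IsRegularPotential.integral_vhat_le {d : ℕ} {V Vhat : Space d → ℝ}
    (hV : IsRegularPotential V Vhat) : ∫ ξ, Vhat ξ ≤ potentialNorm Vhat := by
  refine integral_mono_ae hV.integrable_vhat hV.integrable ?_
  filter_upwards [hV.nonneg] with ξ h
  nlinarith [norm_nonneg ξ]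

/-- The inverse Fourier integral `∫ Vhat(ξ) e^{iξ·x} dξ`. -/
def invFourier {d : ℕ} (Vhat : Space d → ℝ) (x : Space d) : ℂ :=
  ∫ ξ, (Vhat ξ : ℂ) * cexp (I * (inner ℝ ξ x : ℝ))

open FourierTransform in
theorem fourierTr_fourierInv {d : ℕ} (χ : 𝓢(Space d, ℂ)) (x : Space d) :
    fourierTr (𝓕⁻ χ : 𝓢(Space d, ℂ)) x
      = (((2 * Real.pi) ^ d : ℝ) : ℂ)⁻¹ * χ ((2 * Real.pi)⁻¹ • x) := by
  rw [fourierTr_eq_fourier, ← SchwartzMap.fourier_coe]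
  simp

theorem norm_cexp_I_mul (r : ℝ) : ‖cexp (I * (r : ℂ))‖ = 1 := by
  rw [mul_comm, Complex.norm_exp_ofReal_mul_I]

-- Fubini, justified by the integrability of `Vhat` and of `χ`. The dilation by `2π` reconciles the
-- phase `e^{iξ·x}` with the phase `e^{2πiξ·x}` of `𝓕⁻`.
open FourierTransform in
theorem integral_mul_fourierInv {d : ℕ} {Vhat : Space d → ℝ} (hV : Integrable Vhat)
    (χ : 𝓢(Space d, ℂ)) :
    ∫ ξ, (Vhat ξ : ℂ) * (𝓕⁻ χ : 𝓢(Space d, ℂ)) ξ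
      = ∫ w, invFourier Vhat ((2 * Real.pi) • w) * χ w := by
  have hint : Integrable (fun p : Space d × Space d =>
      (Vhat p.1 : ℂ) * cexp (I * (inner ℝ p.1 ((2 * Real.pi) • p.2) : ℝ)) * χ p.2)
      (volume.prod volume) := by
    have h0 : Integrable (fun p : Space d × Space d => (Vhat p.1 : ℂ) * χ p.2)
      (volume.prod volume) := hV.ofReal.mul_prod χ.integrable
    have h1 := h0.bdd_mul (c := 1)
      (f := fun p : Space d × Space d => cexp (I * (inner ℝ p.1 ((2 * Real.pi) • p.2) : ℝ)))
      (by fun_prop) (Filter.Eventually.of_forall fun p => (norm_cexp_I_mul _).le)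
    refine h1.congr (Filter.Eventually.of_forall fun p => ?_)
    simp only; ring
  have hs := integral_integral_swap (μ := volume) (ν := volume)
    (f := fun ξ w : Space d => (Vhat ξ : ℂ) * cexp (I * (inner ℝ ξ ((2 * Real.pi) • w) : ℝ)) * χ w)
    hint
  simp only [integral_mul_const] at hs
  rw [show (∫ w, invFourier Vhat ((2 * Real.pi) • w) * χ w) = _ from hs.symm]
  refine integral_congr_ae (Filter.Eventually.of_forall fun ξ => ?_)
  simp only [SchwartzMap.fourierInv_coe]
  rw [Real.fourierInv_eq', ← integral_const_mul]
  refine integral_congr_ae (Filter.Eventually.of_forall fun w => ?_)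
  simp only [smul_eq_mul, mul_assoc, real_inner_smul_right, real_inner_comm ξ w]
  congr 3
  push_cast
  ring

theorem continuous_invFourier {d : ℕ} {Vhat : Space d → ℝ} (hV : Integrable Vhat) :
    Continuous (invFourier Vhat) := by
  refine continuous_of_dominated (bound := fun ξ => ‖Vhat ξ‖) (fun x => ?_) (fun x => ?_)
    hV.norm (Filter.Eventually.of_forall fun ξ => by fun_prop)
  · exact hV.ofReal.aestronglyMeasurable.mul (by fun_prop)
  · refine Filter.Eventually.of_forall fun ξ => ?_
    simp

open FourierTransform in
/-- A regular potential is almost everywhere the inverse Fourier integral of `Vhat`. -/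
theorem IsRegularPotential.ae_eq_invFourier {d : ℕ} {V Vhat : Space d → ℝ}
    (hV : IsRegularPotential V Vhat) : (fun x => (V x : ℂ)) =ᵐ[volume] invFourier Vhat := by
  set c : ℝ := 2 * Real.pi with hc
  have hc0 : 0 < c := by positivity
  -- The test function `𝓕⁻ χ` has transform `χ` up to a dilation by `2π` and a constant, so the
  -- distributional identity becomes a pairing of the dilated potential with an arbitrary `χ`.
  have key : ∀ χ : 𝓢(Space d, ℂ), Integrable (fun w => (V (c • w) : ℂ) * χ w) ∧
      ∫ w, (V (c • w) : ℂ) * χ w = ∫ w, invFourier Vhat (c • w) * χ w := by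
    intro χ
    obtain ⟨h1, -, h3⟩ := hV.fourier (𝓕⁻ χ : 𝓢(Space d, ℂ))
    have e : ∀ w : Space d, (V (c • w) : ℂ) * χ w
        = ((c ^ d : ℝ) : ℂ) * ((V (c • w) : ℂ) * fourierTr (𝓕⁻ χ : 𝓢(Space d, ℂ)) (c • w)) := by
      intro w
      rw [fourierTr_fourierInv, smul_smul, inv_mul_cancel₀ hc0.ne', one_smul]
      have : ((c ^ d : ℝ) : ℂ) ≠ 0 := by exact_mod_cast (pow_pos hc0 d).ne'
      rw [← hc]
      field_simp
    constructor
    · simp_rw [e]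
      exact (h1.comp_smul hc0.ne').const_mul _
    · simp_rw [e]
      rw [integral_const_mul, Measure.integral_comp_smul volume
        (fun x => (V x : ℂ) * fourierTr (𝓕⁻ χ : 𝓢(Space d, ℂ)) x) c, h3,
        integral_mul_fourierInv hV.integrable_vhat, finrank_euclideanSpace_fin,
        abs_of_pos (by positivity), Complex.real_smul, ← mul_assoc, ← Complex.ofReal_mul,
        mul_inv_cancel₀ (by positivity)]
      simp [hc]
  have key' : ∀ g : Space d → ℝ, ContDiff ℝ (⊤ : ℕ∞) g → HasCompactSupport g →
      Integrable (fun w => (V (c • w) : ℂ) * (g w : ℂ)) ∧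
      ∫ w, (V (c • w) : ℂ) * (g w : ℂ) = ∫ w, invFourier Vhat (c • w) * (g w : ℂ) := by
    intro g hg hgc
    have hb : HasCompactSupport (fun w => ((g w : ℝ) : ℂ)) :=
      hgc.comp_left (g := fun r : ℝ => (r : ℂ)) (by simp)
    have hb' : ContDiff ℝ (⊤ : ℕ∞) (fun w => ((g w : ℝ) : ℂ)) :=
      Complex.ofRealCLM.contDiff.comp hg
    exact key (hb.toSchwartzMap hb')
  -- Integrability against a bump function equal to `1` on a ball gives integrability of the dilated
  -- potential on that ball.
  have hloc : LocallyIntegrable (fun w => (V (c • w) : ℂ)) := by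
    intro x
    let b : ContDiffBump x := ⟨1, 2, one_pos, one_lt_two⟩
    refine ⟨Metric.closedBall x 1, Metric.closedBall_mem_nhds x one_pos, ?_⟩
    refine ((key' b b.contDiff b.hasCompactSupport).1.integrableOn (s := Metric.closedBall x 1)).congr_fun
      (fun w hw => ?_) Metric.isClosed_closedBall.measurableSet
    have : b w = 1 := b.one_of_mem_closedBall hw
    simp [this]
  have hloc' : LocallyIntegrable (fun w => invFourier Vhat (c • w)) :=
    ((continuous_invFourier hV.integrable_vhat).comp (continuous_const_smul c)).locallyIntegrable
  have h0 : (fun w => (V (c • w) : ℂ)) =ᵐ[volume] fun w => invFourier Vhat (c • w) := by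
    refine ae_eq_of_integral_contDiff_smul_eq hloc hloc' fun g hg hgc => ?_
    simpa [mul_comm] using (key' g hg hgc).2
  -- The almost everywhere identity holds for the dilated functions; dilations preserve null sets,
  -- so it can be scaled back.
  have hq : Measure.QuasiMeasurePreserving (fun x : Space d => c⁻¹ • x) volume volume := by
    refine ⟨measurable_const_smul _, ?_⟩
    rw [Measure.map_addHaar_smul _ (inv_ne_zero hc0.ne')]
    exact Measure.smul_absolutelyContinuous
  filter_upwards [hq.ae h0] with x hx
  simpa [smul_smul, mul_inv_cancel₀ hc0.ne'] using hx

variable {d n M : ℕ}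

/-! ### Splitting off the first variable -/

theorem measurePreserving_split (d n : ℕ) :
    MeasurePreserving (fun Z : Fin (n + 1) → Space d => (Z 0, Fin.tail Z))
      volume (volume.prod volume) :=
  volume_preserving_piFinSuccAbove (fun _ : Fin (n + 1) => Space d) 0

theorem measurePreserving_cons (d n : ℕ) :
    MeasurePreserving (fun p : Space d × (Fin n → Space d) => (Fin.cons p.1 p.2 : Fin (n + 1) → Space d))
      (volume.prod volume) volume := by
  have h := (volume_preserving_piFinSuccAbove (fun _ : Fin (n + 1) => Space d) 0).symm
  have e : (fun p : Space d × (Fin n → Space d) => (Fin.cons p.1 p.2 : Fin (n + 1) → Space d))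
      = (MeasurableEquiv.piFinSuccAbove (fun _ : Fin (n + 1) => Space d) 0).symm := by
    funext p
    exact (Fin.insertNth_zero' p.1 p.2).symm
  rw [e]
  exact h

theorem integral_split (F : Space d → (Fin n → Space d) → ℂ) :
    ∫ Z : Fin (n + 1) → Space d, F (Z 0) (Fin.tail Z) = ∫ p : Space d × (Fin n → Space d), F p.1 p.2 :=
  (measurePreserving_split d n).integral_comp
    (MeasurableEquiv.piFinSuccAbove (fun _ : Fin (n + 1) => Space d) 0).measurableEmbedding
    (fun p => F p.1 p.2)

theorem integral_cons (F : (Fin (n + 1) → Space d) → ℂ) :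
    ∫ p : Space d × (Fin n → Space d), F (Fin.cons p.1 p.2) = ∫ Z, F Z := by
  rw [← integral_split fun x X => F (Fin.cons x X)]
  simp

theorem integrable_cons {F : (Fin (n + 1) → Space d) → ℂ} (hF : Integrable F) :
    Integrable (fun p : Space d × (Fin n → Space d) => F (Fin.cons p.1 p.2))
      (volume.prod volume) :=
  (measurePreserving_cons d n).integrable_comp_of_integrable hF

theorem ae_cons {P : (Fin (n + 1) → Space d) → Prop} (h : ∀ᵐ Z, P Z) :
    ∀ᵐ p : Space d × (Fin n → Space d), P (Fin.cons p.1 p.2) :=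
  (measurePreserving_cons d n).quasiMeasurePreserving.ae h

theorem ae_ae_cons {P : (Fin (n + 1) → Space d) → Prop} (h : ∀ᵐ Z, P Z) :
    ∀ᵐ x : Space d, ∀ᵐ X : Fin n → Space d, P (Fin.cons x X) :=
  Measure.ae_ae_of_ae_prod (ae_cons h)

theorem ae_ae_cons' {P : (Fin (n + 1) → Space d) → Prop} (h : ∀ᵐ Z, P Z) :
    ∀ᵐ X : Fin n → Space d, ∀ᵐ x : Space d, P (Fin.cons x X) :=
  Measure.ae_ae_of_ae_prod (Measure.measurePreserving_swap.quasiMeasurePreserving.ae (ae_cons h))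

theorem ae_zero_var {P : Space d → Prop} (h : ∀ᵐ x, P x) :
    ∀ᵐ Z : Fin (n + 1) → Space d, P (Z 0) :=
  (Measure.quasiMeasurePreserving_fst.comp
    (measurePreserving_split d n).quasiMeasurePreserving).ae h

theorem ae_tail {P : (Fin n → Space d) → Prop} (h : ∀ᵐ X, P X) :
    ∀ᵐ Z : Fin (n + 1) → Space d, P (Fin.tail Z) :=
  (Measure.quasiMeasurePreserving_snd.comp
    (measurePreserving_split d n).quasiMeasurePreserving).ae h

/-! ### The tensor product with a one-particle function -/

theorem memLp_tensor (g : OneParticle d) (χ : NParticle d n) :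
    MemLp (fun Z : Fin (n + 1) → Space d => g (Z 0) * χ (Fin.tail Z)) 2 := by
  have hm : AEStronglyMeasurable (fun Z : Fin (n + 1) → Space d => g (Z 0) * χ (Fin.tail Z)) := by
    have h : AEStronglyMeasurable (fun p : Space d × (Fin n → Space d) => g p.1 * χ p.2)
        (volume.prod volume) :=
      (Lp.aestronglyMeasurable g).comp_fst.mul (Lp.aestronglyMeasurable χ).comp_snd
    exact h.comp_measurePreserving (measurePreserving_split d n)
  rw [memLp_two_iff_integrable_sq_norm hm]
  have hg := (memLp_two_iff_integrable_sq_norm (Lp.aestronglyMeasurable g)).1 (Lp.memLp g)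
  have hχ := (memLp_two_iff_integrable_sq_norm (Lp.aestronglyMeasurable χ)).1 (Lp.memLp χ)
  have := (measurePreserving_split d n).integrable_comp_of_integrable (hg.mul_prod hχ)
  refine this.congr (Filter.Eventually.of_forall fun Z => ?_)
  simp [mul_pow]

theorem inner_eq_integral {α : Type*} [MeasureSpace α] (F G : Lp ℂ 2 (volume : Measure α)) :
    inner ℂ F G = ∫ x, conj (F x) * G x := by
  rw [L2.inner_def]
  refine integral_congr_ae (Filter.Eventually.of_forall fun x => ?_)
  simp [mul_comm]

theorem inner_tensor (g h : OneParticle d) (χ η : NParticle d n) :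
    inner ℂ ((memLp_tensor g χ).toLp _ : NParticle d (n + 1)) ((memLp_tensor h η).toLp _)
      = inner ℂ g h * inner ℂ χ η := by
  rw [inner_eq_integral, inner_eq_integral, inner_eq_integral, ← integral_prod_mul,
    show (volume.prod volume : Measure (Space d × (Fin n → Space d))) = volume from rfl,
    ← integral_split (d := d) (n := n) fun x X => conj (g x) * h x * (conj (χ X) * η X)]
  refine integral_congr_ae ?_
  filter_upwards [(memLp_tensor g χ).coeFn_toLp, (memLp_tensor h η).coeFn_toLp] with Z h1 h2
  rw [h1, h2, map_mul]
  ring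

theorem norm_tensor (g : OneParticle d) (χ : NParticle d n) :
    ‖((memLp_tensor g χ).toLp _ : NParticle d (n + 1))‖ = ‖g‖ * ‖χ‖ := by
  have h := inner_tensor g g χ χ
  simp only [inner_self_eq_norm_sq_to_K] at h
  have h' : ‖((memLp_tensor g χ).toLp _ : NParticle d (n + 1))‖ ^ 2 = (‖g‖ * ‖χ‖) ^ 2 := by
    rw [mul_pow]; exact_mod_cast h
  exact (sq_eq_sq₀ (norm_nonneg _) (by positivity)).1 h'

/-- `χ ↦ g ⊗ χ`, from `n` to `n + 1` particles. -/
def tensor (n : ℕ) (g : OneParticle d) : NParticle d n →L[ℂ] NParticle d (n + 1) :=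
  LinearMap.mkContinuous
    { toFun := fun χ => (memLp_tensor g χ).toLp _
      map_add' := fun χ η => by
        rw [← MemLp.toLp_add]
        refine MemLp.toLp_congr _ _ ?_
        filter_upwards [ae_tail (Lp.coeFn_add χ η)] with Z h
        simp only [h, Pi.add_apply, mul_add]
      map_smul' := fun c χ => by
        rw [RingHom.id_apply, ← MemLp.toLp_const_smul]
        refine MemLp.toLp_congr _ _ ?_
        filter_upwards [ae_tail (Lp.coeFn_smul c χ)] with Z h
        simp only [h, Pi.smul_apply, smul_eq_mul, mul_left_comm] } ‖g‖ fun χ => (norm_tensor g χ).le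

theorem coeFn_tensor (g : OneParticle d) (χ : NParticle d n) :
    tensor n g χ =ᵐ[volume] fun Z => g (Z 0) * χ (Fin.tail Z) :=
  (memLp_tensor g χ).coeFn_toLp

theorem inner_tensor_tensor (g h : OneParticle d) (χ η : NParticle d n) :
    inner ℂ (tensor n g χ) (tensor n h η) = inner ℂ g h * inner ℂ χ η := inner_tensor g h χ η

theorem norm_tensor_apply (g : OneParticle d) (χ : NParticle d n) :
    ‖tensor n g χ‖ = ‖g‖ * ‖χ‖ := norm_tensor g χ

theorem norm_tensor_le (g : OneParticle d) : ‖tensor n g‖ ≤ ‖g‖ :=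
  ContinuousLinearMap.opNorm_le_bound _ (norm_nonneg g) fun χ => (norm_tensor_apply g χ).le

theorem tensor_add_apply (g h : OneParticle d) (χ : NParticle d n) :
    tensor n (g + h) χ = tensor n g χ + tensor n h χ := by
  apply Lp.ext
  filter_upwards [coeFn_tensor (g + h) χ, coeFn_tensor g χ, coeFn_tensor h χ,
    Lp.coeFn_add (tensor n g χ) (tensor n h χ), ae_zero_var (n := n) (Lp.coeFn_add g h)]
    with Z h1 h2 h3 h4 h5
  rw [h1, h4, Pi.add_apply, h2, h3, h5, Pi.add_apply, add_mul]

theorem tensor_smul_apply (c : ℂ) (g : OneParticle d) (χ : NParticle d n) :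
    tensor n (c • g) χ = c • tensor n g χ := by
  apply Lp.ext
  filter_upwards [coeFn_tensor (c • g) χ, coeFn_tensor g χ,
    Lp.coeFn_smul c (tensor n g χ), ae_zero_var (n := n) (Lp.coeFn_smul c g)]
    with Z h1 h2 h4 h5
  rw [h1, h4, Pi.smul_apply, h2, h5, Pi.smul_apply, smul_eq_mul, smul_eq_mul, mul_assoc]

/-! ### Contraction of the first variable -/

open ContinuousLinearMap in
/-- Contraction of the first variable with `g`, from `n + 1` to `n` particles. -/
def contract (n : ℕ) (g : OneParticle d) : NParticle d (n + 1) →L[ℂ] NParticle d n :=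
  adjoint (tensor n g)

theorem inner_contract_right (g : OneParticle d) (χ : NParticle d n) (Φ : NParticle d (n + 1)) :
    inner ℂ χ (contract n g Φ) = inner ℂ (tensor n g χ) Φ :=
  ContinuousLinearMap.adjoint_inner_right _ _ _

theorem inner_contract_left (g : OneParticle d) (χ : NParticle d n) (Φ : NParticle d (n + 1)) :
    inner ℂ (contract n g Φ) χ = inner ℂ Φ (tensor n g χ) :=
  ContinuousLinearMap.adjoint_inner_left _ _ _

theorem contract_tensor (g h : OneParticle d) (χ : NParticle d n) :
    contract n g (tensor n h χ) = inner ℂ g h • χ := by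
  refine ext_inner_left ℂ fun η => ?_
  rw [inner_contract_right, inner_tensor_tensor, inner_smul_right]

theorem norm_contract_le (g : OneParticle d) (Φ : NParticle d (n + 1)) :
    ‖contract n g Φ‖ ≤ ‖g‖ * ‖Φ‖ := by
  refine (ContinuousLinearMap.le_opNorm _ _).trans ?_
  gcongr
  rw [contract, LinearIsometryEquiv.norm_map]
  exact norm_tensor_le g

theorem integrable_conj_mul {α : Type*} [MeasureSpace α] (F G : Lp ℂ 2 (volume : Measure α)) :
    Integrable (fun x => conj (F x) * G x) := by
  refine (L2.integrable_inner (𝕜 := ℂ) F G).congr (Filter.Eventually.of_forall fun x => ?_)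
  simp [mul_comm]

/-- The adjoint is tested against indicators of sets of finite measure. Pairing `Φ` with `g ⊗ 1_s`
and applying Fubini shows that both sides have the same integral over every such set `s`. -/
theorem coeFn_contract (g : OneParticle d) (Φ : NParticle d (n + 1)) :
    contract n g Φ =ᵐ[volume] fun X => ∫ y, conj (g y) * Φ (Fin.cons y X) := by
  have key : ∀ s : Set (Fin n → Space d), MeasurableSet s → ∀ hs : volume s < ∞,
      Integrable (fun p : Space d × (Fin n → Space d) =>
        conj (g p.1) * Φ (Fin.cons p.1 p.2)) (volume.prod (volume.restrict s)) ∧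
      ∫ X in s, contract n g Φ X = ∫ X in s, ∫ y, conj (g y) * Φ (Fin.cons y X) := by
    intro s hs hμ
    have e1 : ∀ᵐ Z : Fin (n + 1) → Space d,
        conj (tensor n g (indicatorConstLp 2 hs hμ.ne (1 : ℂ)) Z) * Φ Z
          = (Set.univ ×ˢ s).indicator
            (fun p : Space d × (Fin n → Space d) => conj (g p.1) * Φ (Fin.cons p.1 p.2))
            (Z 0, Fin.tail Z) := by
      filter_upwards [coeFn_tensor g (indicatorConstLp 2 hs hμ.ne (1 : ℂ)),
        ae_tail (indicatorConstLp_coeFn (p := 2) (hs := hs) (hμs := hμ.ne) (c := (1 : ℂ)))]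
        with Z h1 h2
      rw [h1, h2]
      by_cases hZ : Fin.tail Z ∈ s <;> simp [hZ]
    have hI := integrable_conj_mul (tensor n g (indicatorConstLp 2 hs hμ.ne (1 : ℂ))) Φ
    have hI' : Integrable ((Set.univ ×ˢ s).indicator
        (fun p : Space d × (Fin n → Space d) => conj (g p.1) * Φ (Fin.cons p.1 p.2)))
        (volume.prod volume) := by
      refine (integrable_cons (hI.congr e1)).congr (Filter.Eventually.of_forall fun p => ?_)
      simp
    rw [integrable_indicator_iff (MeasurableSet.univ.prod hs), IntegrableOn,
      ← Measure.prod_restrict, Measure.restrict_univ] at hI'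
    refine ⟨hI', ?_⟩
    rw [← L2.inner_indicatorConstLp_one (𝕜 := ℂ) hs hμ.ne, inner_contract_right,
      inner_eq_integral, integral_congr_ae e1, integral_split (d := d) (n := n)
      fun x X => (Set.univ ×ˢ s).indicator
            (fun p : Space d × (Fin n → Space d) => conj (g p.1) * Φ (Fin.cons p.1 p.2)) (x, X),
      ← integral_prod_symm _ hI']
    rw [integral_indicator (MeasurableSet.univ.prod hs)]
    rw [Measure.volume_eq_prod, ← Measure.prod_restrict, Measure.restrict_univ]
  refine ae_eq_of_forall_setIntegral_eq_of_sigmaFinite (fun s hs hμ => ?_) (fun s hs hμ => ?_)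
    fun s hs hμ => (key s hs hμ).2
  · exact integrableOn_Lp_of_measure_ne_top _ (by norm_num) hμ.ne
  · exact (key s hs hμ).1.integral_prod_right

/-! ### Totality of the tensors -/

theorem ae_memLp_slice (Φ : NParticle d (n + 1)) :
    ∀ᵐ X : Fin n → Space d, MemLp (fun y => Φ (Fin.cons y X)) 2 := by
  have hm : AEStronglyMeasurable (fun p : Space d × (Fin n → Space d) => Φ (Fin.cons p.1 p.2))
      (volume.prod volume) :=
    (Lp.aestronglyMeasurable Φ).comp_measurePreserving (measurePreserving_cons d n)
  have hi := (memLp_two_iff_integrable_sq_norm (Lp.aestronglyMeasurable Φ)).1 (Lp.memLp Φ)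
  have hi' := (measurePreserving_cons d n).integrable_comp_of_integrable hi
  filter_upwards [hm.prod_swap.prodMk_left, hi'.prod_left_ae] with X h1 h2
  exact (memLp_two_iff_integrable_sq_norm h1).2 h2

/-- Almost every slice of `Φ` in its first variable is square integrable and orthogonal to a dense
sequence, hence zero. -/
theorem eq_zero_of_contract_eq_zero {Φ : NParticle d (n + 1)}
    (h : ∀ g : OneParticle d, contract n g Φ = 0) : Φ = 0 := by
  -- The finite exponent makes `L²` separable; a countable dense family then allows one null set to
  -- serve all test functions.
  have : Fact ((2 : ℝ≥0∞) ≠ ∞) := ⟨by simp⟩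
  have hD := TopologicalSpace.denseRange_denseSeq (OneParticle d)
  set b := TopologicalSpace.denseSeq (OneParticle d)
  have h1 : ∀ᵐ X : Fin n → Space d, ∀ j, ∫ y, conj (b j y) * Φ (Fin.cons y X) = 0 := by
    refine ae_all_iff.2 fun j => ?_
    filter_upwards [coeFn_contract (b j) Φ, Lp.coeFn_zero ℂ 2 (volume : Measure (Fin n → Space d))]
      with X hX h0
    rw [← hX, h, h0, Pi.zero_apply]
  have h2 : ∀ᵐ X : Fin n → Space d, (fun y => Φ (Fin.cons y X)) =ᵐ[volume] 0 := by
    filter_upwards [h1, ae_memLp_slice Φ] with X hX hm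
    have : hm.toLp _ = 0 := by
      refine hD.eq_zero_of_inner_right ℂ fun x => ?_
      rw [inner_eq_integral, ← hX x]
      refine integral_congr_ae ?_
      filter_upwards [hm.coeFn_toLp] with y hy
      rw [hy]
    exact hm.coeFn_toLp.symm.trans ((Lp.eq_zero_iff_ae_eq_zero).1 this)
  have h3 : inner ℂ Φ Φ = 0 := by
    rw [inner_eq_integral, ← integral_cons, Measure.volume_eq_prod,
      integral_prod_symm _ (integrable_cons (integrable_conj_mul Φ Φ))]
    refine integral_eq_zero_of_ae ?_
    filter_upwards [h2] with X hX
    refine integral_eq_zero_of_ae ?_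
    filter_upwards [hX] with y hy
    simp [hy]
  exact inner_self_eq_zero.1 h3

/-- Operators that agree on all `g ⊗ χ` are equal. -/
theorem ext_tensor {H : Type*} [NormedAddCommGroup H] [InnerProductSpace ℂ H] [CompleteSpace H]
    {K L : NParticle d (n + 1) →L[ℂ] H}
    (h : ∀ (g : OneParticle d) (χ : NParticle d n), K (tensor n g χ) = L (tensor n g χ)) :
    K = L := by
  rw [← sub_eq_zero]
  ext1 Φ
  refine ext_inner_right ℂ fun y => ?_
  -- Agreement on tensors means that every contraction of `(K - L)* y` vanishes, so `(K - L)* y =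
  -- 0`.
  rw [← ContinuousLinearMap.adjoint_inner_right,
    eq_zero_of_contract_eq_zero (Φ := ContinuousLinearMap.adjoint (K - L) y) fun g => ?_]
  · simp
  · refine ext_inner_left ℂ fun χ => ?_
    rw [inner_contract_right, ContinuousLinearMap.adjoint_inner_right]
    simp [h]

theorem ext_tensor_tensor {H : Type*} [NormedAddCommGroup H] [InnerProductSpace ℂ H]
    [CompleteSpace H] {K L : NParticle d (n + 2) →L[ℂ] H}
    (h : ∀ (a b : OneParticle d) (χ : NParticle d n),
      K (tensor (n + 1) a (tensor n b χ)) = L (tensor (n + 1) a (tensor n b χ))) :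
    K = L := by
  refine ext_tensor fun a χ => ?_
  have : K ∘L tensor (n + 1) a = L ∘L tensor (n + 1) a := ext_tensor fun b χ => h a b χ
  exact congrArg (fun T => T χ) this

/-! ### Permutation operators -/

/-- Permutation of the variables, as an operator on `n` particles. -/
def perm (d : ℕ) {n : ℕ} (σ : Equiv.Perm (Fin n)) : NParticle d n →L[ℂ] NParticle d n :=
  (Lp.compMeasurePreservingₗᵢ ℂ _ (measurePreserving_perm d n σ)).toContinuousLinearMap

theorem coeFn_perm (σ : Equiv.Perm (Fin n)) (Φ : NParticle d n) :
    perm d σ Φ =ᵐ[volume] fun X => Φ (fun i => X (σ i)) :=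
  Lp.coeFn_compMeasurePreserving Φ (measurePreserving_perm d n σ)

theorem ae_perm (σ : Equiv.Perm (Fin n)) {P : (Fin n → Space d) → Prop} (h : ∀ᵐ X, P X) :
    ∀ᵐ X : Fin n → Space d, P (fun i => X (σ i)) :=
  (measurePreserving_perm d n σ).quasiMeasurePreserving.ae h

theorem inner_perm_perm (σ : Equiv.Perm (Fin n)) (Φ Ψ : NParticle d n) :
    inner ℂ (perm d σ Φ) (perm d σ Ψ) = inner ℂ Φ Ψ :=
  LinearIsometry.inner_map_map
    (Lp.compMeasurePreservingₗᵢ ℂ _ (measurePreserving_perm d n σ)) Φ Ψ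

theorem norm_perm (σ : Equiv.Perm (Fin n)) (Φ : NParticle d n) : ‖perm d σ Φ‖ = ‖Φ‖ :=
  (Lp.compMeasurePreservingₗᵢ ℂ _ (measurePreserving_perm d n σ)).norm_map Φ

theorem perm_mul (σ τ : Equiv.Perm (Fin n)) (Φ : NParticle d n) :
    perm d (σ * τ) Φ = perm d σ (perm d τ Φ) := by
  apply Lp.ext
  filter_upwards [coeFn_perm (σ * τ) Φ, coeFn_perm σ (perm d τ Φ), ae_perm σ (coeFn_perm τ Φ)]
    with X h1 h2 h3
  rw [h1, h2, h3]
  rfl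

theorem perm_one (Φ : NParticle d n) : perm d 1 Φ = Φ := by
  apply Lp.ext
  filter_upwards [coeFn_perm 1 Φ] with X h1
  rw [h1]
  rfl

theorem perm_inv_perm (σ : Equiv.Perm (Fin n)) (Φ : NParticle d n) :
    perm d σ⁻¹ (perm d σ Φ) = Φ := by
  rw [← perm_mul, inv_mul_cancel, perm_one]

theorem inner_perm_left (σ : Equiv.Perm (Fin n)) (Φ Ψ : NParticle d n) :
    inner ℂ (perm d σ Φ) Ψ = inner ℂ Φ (perm d σ⁻¹ Ψ) := by
  rw [← inner_perm_perm σ⁻¹ (perm d σ Φ) Ψ, perm_inv_perm]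

theorem perm_tensor {σ : Equiv.Perm (Fin (n + 1))} {τ : Equiv.Perm (Fin n)} (h0 : σ 0 = 0)
    (hs : ∀ i, σ (Fin.succ i) = Fin.succ (τ i)) (g : OneParticle d) (χ : NParticle d n) :
    perm d σ (tensor n g χ) = tensor n g (perm d τ χ) := by
  apply Lp.ext
  filter_upwards [coeFn_perm σ (tensor n g χ), ae_perm σ (coeFn_tensor g χ),
    coeFn_tensor g (perm d τ χ), ae_tail (coeFn_perm τ χ)] with Z h1 h2 h3 h4
  rw [h1, h2, h3, h4, h0]
  congr 2
  funext i
  simp [Fin.tail, hs]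

theorem exists_perm_succ {σ : Equiv.Perm (Fin (n + 1))} (h0 : σ 0 = 0) :
    ∃ τ : Equiv.Perm (Fin n), ∀ i, σ (Fin.succ i) = Fin.succ (τ i) := by
  obtain ⟨⟨p, τ⟩, rfl⟩ := Equiv.Perm.decomposeFin.symm.surjective σ
  have hp : p = 0 := by simpa using h0
  subst hp
  exact ⟨τ, fun i => by simp⟩

/-- Exchange of the first two variables. -/
def flip (d n : ℕ) : NParticle d (n + 2) →L[ℂ] NParticle d (n + 2) :=
  perm d (Equiv.swap 0 1)

theorem flip_flip (Φ : NParticle d (n + 2)) : flip d n (flip d n Φ) = Φ := by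
  rw [flip, ← perm_mul, Equiv.swap_mul_self, perm_one]

theorem inner_flip_left (Φ Ψ : NParticle d (n + 2)) :
    inner ℂ (flip d n Φ) Ψ = inner ℂ Φ (flip d n Ψ) := by
  rw [flip, inner_perm_left, Equiv.swap_inv]

theorem norm_flip (Φ : NParticle d (n + 2)) : ‖flip d n Φ‖ = ‖Φ‖ := norm_perm _ Φ

theorem flip_tensor_tensor (a b : OneParticle d) (χ : NParticle d n) :
    flip d n (tensor (n + 1) a (tensor n b χ)) = tensor (n + 1) b (tensor n a χ) := by
  apply Lp.ext
  filter_upwards [coeFn_perm (Equiv.swap 0 1) (tensor (n + 1) a (tensor n b χ)),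
    ae_perm (Equiv.swap 0 1) (coeFn_tensor a (tensor n b χ)),
    ae_perm (Equiv.swap 0 1) (ae_tail (coeFn_tensor b χ)),
    coeFn_tensor b (tensor n a χ), ae_tail (coeFn_tensor a χ)] with Z h1 h2 h3 h4 h5
  rw [flip, h1, h2, h3, h4, h5]
  have e : Fin.tail (Fin.tail fun i => Z ((Equiv.swap 0 1) i)) = Fin.tail (Fin.tail Z) := by
    funext i
    simp only [Fin.tail]
    rw [Equiv.swap_apply_of_ne_of_ne (Fin.succ_ne_zero _)]
    exact fun h => Fin.succ_ne_zero i (Fin.succ_injective _ h)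
  rw [e]
  simp only [Fin.tail, Equiv.swap_apply_left, Fin.succ_zero_eq_one, Equiv.swap_apply_right]
  ring

/-- `T_h† U (g ⊗ G) = g ⊗ (T_h† G)` for the exchange `U` of the first two variables. -/
theorem contract_flip_tensor (g h : OneParticle d) (G : NParticle d (n + 1)) :
    contract (n + 1) h (flip d n (tensor (n + 1) g G)) = tensor n g (contract n h G) := by
  have : contract (n + 1) h ∘L flip d n ∘L tensor (n + 1) g = tensor n g ∘L contract n h := by
    refine ext_tensor fun a χ => ?_
    simp only [ContinuousLinearMap.comp_apply]
    rw [flip_tensor_tensor, contract_tensor, contract_tensor, map_smul]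
  exact congrArg (fun T => T G) this

theorem inner_flip_tensor_tensor (g h : OneParticle d) (G H : NParticle d (n + 1)) :
    inner ℂ (flip d n (tensor (n + 1) g G)) (tensor (n + 1) h H)
      = inner ℂ (contract n h G) (contract n g H) := by
  rw [← inner_contract_left, contract_flip_tensor, ← inner_contract_right]

/-! ### Multiplication by a character of the first variable -/

theorem coeFn_expMul (ξ : Space d) (g : OneParticle d) :
    expMul ξ g =ᵐ[volume] fun x => cexp (I * (inner ℝ ξ x : ℝ)) * g x := by
  have hm : MemLp (fun x : Space d => cexp (I * (inner ℝ ξ x : ℝ))) ∞ (volume : Measure (Space d)) :=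
    memLp_top_of_bound (by fun_prop) 1
      (Filter.Eventually.of_forall fun x => (norm_cexp_I_mul _).le)
  filter_upwards [(ContinuousLinearMap.mul ℂ ℂ).coeFn_holder (r := 2) (hm.toLp _) g,
    hm.coeFn_toLp] with x h1 h2
  have : (expMul ξ g : Space d → ℂ) x = _ := h1
  rw [this, h2]
  rfl

theorem memLp_phase (ξ : Space d) (Φ : NParticle d (n + 1)) :
    MemLp (fun Z : Fin (n + 1) → Space d => cexp (I * (inner ℝ ξ (Z 0) : ℝ)) * Φ Z) 2 := by
  refine (Lp.memLp Φ).of_le ?_ (Filter.Eventually.of_forall fun Z => ?_)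
  · exact AEStronglyMeasurable.mul (Continuous.aestronglyMeasurable (by fun_prop)) (Lp.aestronglyMeasurable Φ)
  · rw [norm_mul, norm_cexp_I_mul, one_mul]

theorem norm_phase (ξ : Space d) (Φ : NParticle d (n + 1)) :
    ‖((memLp_phase ξ Φ).toLp _ : NParticle d (n + 1))‖ = ‖Φ‖ := by
  rw [Lp.norm_def, Lp.norm_def]
  refine congrArg _ (eLpNorm_congr_norm_ae ?_)
  filter_upwards [(memLp_phase ξ Φ).coeFn_toLp] with Z h
  rw [h, norm_mul, norm_cexp_I_mul, one_mul]

/-- Multiplication by `e^{iξ·x}` in the first variable. -/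
def phase (n : ℕ) (ξ : Space d) : NParticle d (n + 1) →L[ℂ] NParticle d (n + 1) :=
  LinearMap.mkContinuous
    { toFun := fun Φ => (memLp_phase ξ Φ).toLp _
      map_add' := fun Φ Ψ => by
        rw [← MemLp.toLp_add]
        refine MemLp.toLp_congr _ _ ?_
        filter_upwards [Lp.coeFn_add Φ Ψ] with Z h
        simp only [h, Pi.add_apply, mul_add]
      map_smul' := fun c Φ => by
        rw [RingHom.id_apply, ← MemLp.toLp_const_smul]
        refine MemLp.toLp_congr _ _ ?_
        filter_upwards [Lp.coeFn_smul c Φ] with Z h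
        simp only [h, Pi.smul_apply, smul_eq_mul, mul_left_comm] } 1
    fun Φ => by rw [one_mul]; exact (norm_phase ξ Φ).le

theorem coeFn_phase (ξ : Space d) (Φ : NParticle d (n + 1)) :
    phase n ξ Φ =ᵐ[volume] fun Z => cexp (I * (inner ℝ ξ (Z 0) : ℝ)) * Φ Z :=
  (memLp_phase ξ Φ).coeFn_toLp

theorem norm_phase_apply (ξ : Space d) (Φ : NParticle d (n + 1)) : ‖phase n ξ Φ‖ = ‖Φ‖ :=
  norm_phase ξ Φ

theorem inner_phase_left (ξ : Space d) (Φ Ψ : NParticle d (n + 1)) :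
    inner ℂ (phase n ξ Φ) Ψ = inner ℂ Φ (phase n (-ξ) Ψ) := by
  rw [inner_eq_integral, inner_eq_integral]
  refine integral_congr_ae ?_
  filter_upwards [coeFn_phase ξ Φ, coeFn_phase (-ξ) Ψ] with Z h1 h2
  rw [h1, h2, map_mul, ← exp_conj]
  simp only [map_mul, conj_I, conj_ofReal, inner_neg_left, ofReal_neg, neg_mul, mul_neg]
  ring

/-! ### Operators acting on the first variable -/

/-- `K` acts as `k` on the first variable. -/
def ActsAs (K : NParticle d (n + 1) →L[ℂ] NParticle d (n + 1))
    (k : OneParticle d →L[ℂ] OneParticle d) : Prop :=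
  ∀ (g : OneParticle d) (χ : NParticle d n), K (tensor n g χ) = tensor n (k g) χ

namespace ActsAs

variable {K L : NParticle d (n + 1) →L[ℂ] NParticle d (n + 1)}
  {k l : OneParticle d →L[ℂ] OneParticle d}

theorem add (hK : ActsAs K k) (hL : ActsAs L l) : ActsAs (K + L) (k + l) := fun g χ => by
  simp [hK g χ, hL g χ, tensor_add_apply]

theorem smul (c : ℂ) (hK : ActsAs K k) : ActsAs (c • K) (c • k) := fun g χ => by
  simp [hK g χ, tensor_smul_apply]

theorem sub (hK : ActsAs K k) (hL : ActsAs L l) : ActsAs (K - L) (k - l) := by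
  simpa [sub_eq_add_neg] using hK.add (hL.smul (-1))

theorem comp (hK : ActsAs K k) (hL : ActsAs L l) : ActsAs (K ∘L L) (k ∘L l) := fun g χ => by
  simp [hK _ χ, hL g χ]

theorem one : ActsAs (1 : NParticle d (n + 1) →L[ℂ] NParticle d (n + 1)) 1 := fun g χ => by simp

theorem zero : ActsAs (0 : NParticle d (n + 1) →L[ℂ] NParticle d (n + 1)) 0 := fun g χ => by
  simpa using (tensor_smul_apply 0 g χ).symm

theorem sum {ι : Type*} (s : Finset ι)
    {K : ι → NParticle d (n + 1) →L[ℂ] NParticle d (n + 1)}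
    {k : ι → OneParticle d →L[ℂ] OneParticle d} (h : ∀ i, ActsAs (K i) (k i)) :
    ActsAs (∑ i ∈ s, K i) (∑ i ∈ s, k i) := by
  classical
  induction s using Finset.induction_on with
  | empty => simpa using zero
  | insert a s ha ih => simpa [Finset.sum_insert ha] using (h a).add ih

theorem rankOne (g h : OneParticle d) :
    ActsAs (tensor n g ∘L contract n h) (InnerProductSpace.rankOne ℂ g h) := fun a χ => by
  simp [contract_tensor, tensor_smul_apply]

theorem phase (ξ : Space d) : ActsAs (phase n ξ) (expMul ξ) := fun g χ => by
  apply Lp.ext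
  filter_upwards [coeFn_phase ξ (tensor n g χ), coeFn_tensor g χ, coeFn_tensor (expMul ξ g) χ,
    ae_zero_var (n := n) (coeFn_expMul ξ g)] with Z h1 h2 h3 h4
  rw [h1, h2, h3, h4, mul_assoc]

/-- Operator identities in the first variable can therefore be verified on the one-particle space.
-/
theorem unique (hK : ActsAs K k) (hL : ActsAs L k) : K = L :=
  ext_tensor fun g χ => by rw [hK, hL]

/-- A permutation fixing the first variable sends `g ⊗ χ` to `g ⊗ U_τ χ`, which does not interfere
with the factor on which `K` acts. -/
theorem perm_comm (hK : ActsAs K k) {σ : Equiv.Perm (Fin (n + 1))} (h0 : σ 0 = 0)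
    (Φ : NParticle d (n + 1)) : K (perm d σ Φ) = perm d σ (K Φ) := by
  obtain ⟨τ, hτ⟩ := exists_perm_succ h0
  have : K ∘L perm d σ = perm d σ ∘L K := ext_tensor fun g χ => by
    simp only [ContinuousLinearMap.comp_apply]
    rw [perm_tensor h0 hτ, hK, hK, perm_tensor h0 hτ]
  exact congrArg (fun T => T Φ) this

end ActsAs

/-- The operator `K` moved to the second variable. -/
def second (K : NParticle d (n + 2) →L[ℂ] NParticle d (n + 2)) :
    NParticle d (n + 2) →L[ℂ] NParticle d (n + 2) :=
  flip d n ∘L K ∘L flip d n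

theorem second_apply (K : NParticle d (n + 2) →L[ℂ] NParticle d (n + 2)) (Φ : NParticle d (n + 2)) :
    second K Φ = flip d n (K (flip d n Φ)) := rfl

theorem second_comp_apply (K L : NParticle d (n + 2) →L[ℂ] NParticle d (n + 2))
    (Φ : NParticle d (n + 2)) : second (K ∘L L) Φ = second K (second L Φ) := by
  simp [second_apply, flip_flip]

/-- Operators acting on different variables commute. -/
theorem ActsAs.second_comm {K L : NParticle d (n + 2) →L[ℂ] NParticle d (n + 2)}
    {k l : OneParticle d →L[ℂ] OneParticle d} (hK : ActsAs K k) (hL : ActsAs L l)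
    (Φ : NParticle d (n + 2)) : K (second L Φ) = second L (K Φ) := by
  have : K ∘L second L = second L ∘L K := ext_tensor_tensor fun a b χ => by
    simp only [ContinuousLinearMap.comp_apply, second_apply]
    rw [flip_tensor_tensor, hL, flip_tensor_tensor, hK, hK, flip_tensor_tensor, hL,
      flip_tensor_tensor]
  exact congrArg (fun T => T Φ) this

theorem inner_second_left {K K' : NParticle d (n + 2) →L[ℂ] NParticle d (n + 2)}
    (h : ∀ Φ Ψ, inner ℂ (K Φ) Ψ = inner ℂ Φ (K' Ψ)) (Φ Ψ : NParticle d (n + 2)) :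
    inner ℂ (second K Φ) Ψ = inner ℂ Φ (second K' Ψ) := by
  rw [second_apply, second_apply, inner_flip_left, h, inner_flip_left]

/-! ### Finite-rank perturbations of multiples of the identity -/

/-- The operator `c + ∑ₖ |gₖ⟩⟨hₖ|` in the first variable. -/
def bodyOp (n : ℕ) (c : ℂ) (g h : Fin M → OneParticle d) :
    NParticle d (n + 1) →L[ℂ] NParticle d (n + 1) :=
  c • 1 + ∑ k, tensor n (g k) ∘L contract n (h k)

/-- The one-particle operator `c + ∑ₖ |gₖ⟩⟨hₖ|`. -/
def bodyOne (c : ℂ) (g h : Fin M → OneParticle d) : OneParticle d →L[ℂ] OneParticle d :=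
  c • 1 + ∑ k, InnerProductSpace.rankOne ℂ (g k) (h k)

theorem bodyOp_apply (c : ℂ) (g h : Fin M → OneParticle d) (Φ : NParticle d (n + 1)) :
    bodyOp n c g h Φ = c • Φ + ∑ k, tensor n (g k) (contract n (h k) Φ) := by
  simp [bodyOp]

theorem bodyOne_apply (c : ℂ) (g h : Fin M → OneParticle d) (x : OneParticle d) :
    bodyOne c g h x = c • x + ∑ k, inner ℂ (h k) x • g k := by
  simp [bodyOne]

theorem actsAs_bodyOp (c : ℂ) (g h : Fin M → OneParticle d) :
    ActsAs (bodyOp n c g h) (bodyOne c g h) :=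
  (ActsAs.one.smul c).add (ActsAs.sum _ fun k => ActsAs.rankOne (g k) (h k))

theorem inner_bodyOp_left (c : ℂ) (g h : Fin M → OneParticle d) (Φ Ψ : NParticle d (n + 1)) :
    inner ℂ (bodyOp n c g h Φ) Ψ = inner ℂ Φ (bodyOp n (conj c) h g Ψ) := by
  simp only [bodyOp_apply, inner_add_left, inner_add_right, inner_smul_left, inner_smul_right,
    sum_inner, inner_sum]
  congr 1
  refine Finset.sum_congr rfl fun k _ => ?_
  rw [← inner_contract_right, inner_contract_left]

/-- The operator `u = 1 - γ` in the first variable. -/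
def uOp (n : ℕ) (f : Fin M → OneParticle d) : NParticle d (n + 1) →L[ℂ] NParticle d (n + 1) :=
  bodyOp n 1 (fun k => -f k) f

/-- The operator `v` in the first variable. -/
def vOp (n : ℕ) (f : Fin M → OneParticle d) : NParticle d (n + 1) →L[ℂ] NParticle d (n + 1) :=
  bodyOp n 0 (fun k => star (f k)) f

/-- The adjoint of `v` in the first variable. -/
def vAdj (n : ℕ) (f : Fin M → OneParticle d) : NParticle d (n + 1) →L[ℂ] NParticle d (n + 1) :=
  bodyOp n 0 f (fun k => star (f k))

theorem inner_star_star (g h : OneParticle d) : inner ℂ (star g) (star h) = inner ℂ h g := by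
  rw [inner_eq_integral, inner_eq_integral]
  refine integral_congr_ae ?_
  filter_upwards [Lp.coeFn_star g, Lp.coeFn_star h] with x h1 h2
  rw [h1, h2]
  simp [mul_comm]

theorem inner_uOp_left (f : Fin M → OneParticle d) (Φ Ψ : NParticle d (n + 1)) :
    inner ℂ (uOp n f Φ) Ψ = inner ℂ Φ (uOp n f Ψ) := by
  have : bodyOp n (conj 1) f (fun k => -f k) = uOp n f := by
    refine (actsAs_bodyOp _ _ _).unique (k := bodyOne (conj 1) f (fun k => -f k)) ?_
    have e : bodyOne (conj 1) f (fun k => -f k) = bodyOne 1 (fun k => -f k) f := by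
      ext1 x
      simp [bodyOne_apply]
    rw [e]
    exact actsAs_bodyOp _ _ _
  rw [uOp, inner_bodyOp_left, this, uOp]

theorem inner_vOp_left (f : Fin M → OneParticle d) (Φ Ψ : NParticle d (n + 1)) :
    inner ℂ (vOp n f Φ) Ψ = inner ℂ Φ (vAdj n f Ψ) := by
  rw [vOp, inner_bodyOp_left, map_zero, vAdj]

theorem inner_vAdj_left (f : Fin M → OneParticle d) (Φ Ψ : NParticle d (n + 1)) :
    inner ℂ (vAdj n f Φ) Ψ = inner ℂ Φ (vOp n f Ψ) := by
  rw [vAdj, inner_bodyOp_left, map_zero, vOp]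

/-- Orthonormality makes `u` the projection onto the complement of the span of the `fⱼ`; both `u² =
u` and `v u = 0` come from this. -/
theorem inner_uOne {f : Fin M → OneParticle d} (hf : Orthonormal ℂ f)
    (x : OneParticle d) (j : Fin M) :
    inner ℂ (f j) (bodyOne 1 (fun k => -f k) f x) = 0 := by
  classical
  rw [bodyOne_apply]
  simp [inner_add_right, inner_sum, inner_smul_right, orthonormal_iff_ite.1 hf]

theorem uOp_uOp {f : Fin M → OneParticle d} (hf : Orthonormal ℂ f)
    (Φ : NParticle d (n + 1)) : uOp n f (uOp n f Φ) = uOp n f Φ := by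
  have h := (actsAs_bodyOp (n := n) 1 (fun k => -f k) f)
  have e : bodyOne 1 (fun k => -f k) f ∘L bodyOne 1 (fun k => -f k) f
      = bodyOne 1 (fun k => -f k) f := by
    ext1 x
    rw [ContinuousLinearMap.comp_apply, bodyOne_apply]
    simp [inner_uOne hf]
  have hh := h.comp h
  rw [e] at hh
  exact congrArg (fun T => T Φ) (hh.unique h)

theorem vOp_uOp {f : Fin M → OneParticle d} (hf : Orthonormal ℂ f)
    (Φ : NParticle d (n + 1)) : vOp n f (uOp n f Φ) = 0 := by
  have h := (actsAs_bodyOp (n := n) 0 (fun k => star (f k)) f).comp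
    (actsAs_bodyOp (n := n) 1 (fun k => -f k) f)
  have e : bodyOne 0 (fun k => star (f k)) f ∘L bodyOne 1 (fun k => -f k) f = 0 := by
    ext1 x
    rw [ContinuousLinearMap.comp_apply, bodyOne_apply]
    simp [inner_uOne hf]
  rw [e] at h
  exact congrArg (fun T => T Φ) (h.unique ActsAs.zero)

/-- Complex conjugation preserves orthonormality, so `v* v = γ = 1 - u`. -/
theorem vAdj_vOp {f : Fin M → OneParticle d} (hf : Orthonormal ℂ f)
    (Φ : NParticle d (n + 1)) : vAdj n f (vOp n f Φ) = Φ - uOp n f Φ := by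
  classical
  have h := (actsAs_bodyOp (n := n) 0 f (fun k => star (f k))).comp
    (actsAs_bodyOp (n := n) 0 (fun k => star (f k)) f)
  have e : bodyOne 0 f (fun k => star (f k)) ∘L bodyOne 0 (fun k => star (f k)) f
      = 1 - bodyOne 1 (fun k => -f k) f := by
    ext1 x
    simp only [ContinuousLinearMap.comp_apply, sub_apply, bodyOne_apply]
    simp [inner_sum, inner_smul_right, inner_star_star, orthonormal_iff_ite.1 hf]
  rw [e] at h
  exact congrArg (fun T => T Φ) (h.unique (ActsAs.one.sub (actsAs_bodyOp 1 (fun k => -f k) f)))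

theorem norm_sq_uOp_add_vOp {f : Fin M → OneParticle d} (hf : Orthonormal ℂ f)
    (Φ : NParticle d (n + 1)) :
    ‖uOp n f Φ‖ ^ 2 + ‖vOp n f Φ‖ ^ 2 = ‖Φ‖ ^ 2 := by
  have h1 : inner ℂ (uOp n f Φ) (uOp n f Φ) = inner ℂ Φ (uOp n f Φ) := by
    rw [inner_uOp_left, uOp_uOp hf]
  have h2 : inner ℂ (vOp n f Φ) (vOp n f Φ) = inner ℂ Φ Φ - inner ℂ Φ (uOp n f Φ) := by
    rw [inner_vOp_left, vAdj_vOp hf, inner_sub_right]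
  rw [← h1] at h2
  simp only [inner_self_eq_norm_sq_to_K] at h2
  have h3 : ‖vOp n f Φ‖ ^ 2 = ‖Φ‖ ^ 2 - ‖uOp n f Φ‖ ^ 2 := by exact_mod_cast h2
  linarith

theorem norm_uOp_le {f : Fin M → OneParticle d} (hf : Orthonormal ℂ f)
    (Φ : NParticle d (n + 1)) : ‖uOp n f Φ‖ ≤ ‖Φ‖ := by
  have := norm_sq_uOp_add_vOp hf Φ
  exact abs_le_of_sq_le_sq' (by nlinarith [sq_nonneg ‖vOp n f Φ‖]) (norm_nonneg _) |>.2

theorem norm_vOp_le {f : Fin M → OneParticle d} (hf : Orthonormal ℂ f)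
    (Φ : NParticle d (n + 1)) : ‖vOp n f Φ‖ ≤ ‖Φ‖ := by
  have := norm_sq_uOp_add_vOp hf Φ
  exact abs_le_of_sq_le_sq' (by nlinarith [sq_nonneg ‖uOp n f Φ‖]) (norm_nonneg _) |>.2

/-- From `‖v* Φ‖² = ⟨Φ, v v* Φ⟩` and the contraction property of `v`. -/
theorem norm_vAdj_le {f : Fin M → OneParticle d} (hf : Orthonormal ℂ f)
    (Φ : NParticle d (n + 1)) : ‖vAdj n f Φ‖ ≤ ‖Φ‖ := by
  have h : ‖vAdj n f Φ‖ ^ 2 ≤ ‖Φ‖ * ‖vAdj n f Φ‖ := by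
    have h1 : inner ℂ (vAdj n f Φ) (vAdj n f Φ) = inner ℂ Φ (vOp n f (vAdj n f Φ)) :=
      inner_vAdj_left f _ _
    rw [inner_self_eq_norm_sq_to_K] at h1
    have h2 := congrArg norm h1
    rw [norm_pow] at h2
    simp only [coe_algebraMap, norm_real, norm_norm] at h2
    rw [h2]
    exact (norm_inner_le_norm _ _).trans (by gcongr; exact norm_vOp_le hf _)
  nlinarith [norm_nonneg (vAdj n f Φ), norm_nonneg Φ]

/-! ### The difference `u e u - v* e v` -/

/-- The operator `u e_ξ u - v* e_ξ v` in the first variable. -/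
def diffOp (n : ℕ) (f : Fin M → OneParticle d) (ξ : Space d) :
    NParticle d (n + 1) →L[ℂ] NParticle d (n + 1) :=
  uOp n f ∘L phase n ξ ∘L uOp n f - vAdj n f ∘L phase n ξ ∘L vOp n f

theorem actsAs_uOp (f : Fin M → OneParticle d) :
    ActsAs (uOp n f) (bodyOne 1 (fun k => -f k) f) := actsAs_bodyOp _ _ _

theorem actsAs_vOp (f : Fin M → OneParticle d) :
    ActsAs (vOp n f) (bodyOne 0 (fun k => star (f k)) f) := actsAs_bodyOp _ _ _

theorem actsAs_vAdj (f : Fin M → OneParticle d) :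
    ActsAs (vAdj n f) (bodyOne 0 f (fun k => star (f k))) := actsAs_bodyOp _ _ _

theorem exists_actsAs_diffOp (f : Fin M → OneParticle d) (ξ : Space d) :
    ∃ k, ActsAs (diffOp n f ξ) k :=
  ⟨_, ((actsAs_uOp f).comp ((ActsAs.phase ξ).comp (actsAs_uOp f))).sub
    ((actsAs_vAdj f).comp ((ActsAs.phase ξ).comp (actsAs_vOp f)))⟩

/-- The two parts lie in the ranges of `u` and `v*`, which are orthogonal because `v u = 0`. By
Pythagoras the squared norm is at most `‖uΦ‖² + ‖vΦ‖² = ‖Φ‖²`; a triangle inequality would lose a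
constant. -/
theorem norm_diffOp_le {f : Fin M → OneParticle d} (hf : Orthonormal ℂ f) (ξ : Space d)
    (Φ : NParticle d (n + 1)) : ‖diffOp n f ξ Φ‖ ≤ ‖Φ‖ := by
  set a := uOp n f (phase n ξ (uOp n f Φ)) with ha
  set b := vAdj n f (phase n ξ (vOp n f Φ)) with hb
  have h0 : inner ℂ a b = 0 := by
    rw [hb, ← inner_vOp_left, ha, vOp_uOp hf, inner_zero_left]
  have h1 : ‖a - b‖ ^ 2 = ‖a‖ ^ 2 + ‖b‖ ^ 2 := by
    rw [norm_sub_sq (𝕜 := ℂ), h0]; simp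
  have h2 : ‖a‖ ≤ ‖uOp n f Φ‖ := (norm_uOp_le hf _).trans (norm_phase_apply _ _).le
  have h3 : ‖b‖ ≤ ‖vOp n f Φ‖ := (norm_vAdj_le hf _).trans (norm_phase_apply _ _).le
  have h4 := norm_sq_uOp_add_vOp hf Φ
  have h5 : diffOp n f ξ Φ = a - b := rfl
  rw [h5]
  have : ‖a - b‖ ^ 2 ≤ ‖Φ‖ ^ 2 := by
    rw [h1, ← h4]; gcongr
  exact abs_le_of_sq_le_sq' this (norm_nonneg _) |>.2

/-! ### Positivity of the Gram matrix of permuted vectors -/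

/-- The right side is `‖∑ᵢ wᵢ‖²` expanded into `m` diagonal and `m(m - 1)` off-diagonal entries. -/
theorem gram_nonneg {H : Type*} [NormedAddCommGroup H] [InnerProductSpace ℂ H] {m : ℕ}
    (w : Fin m → H) {a b : ℝ} (ha : ∀ i, ‖w i‖ ^ 2 = a)
    (hb : ∀ i j, i ≠ j → (inner ℂ (w i) (w j)).re = b) : 0 ≤ m * a + m * (m - 1) * b := by
  classical
  have h : ‖∑ i, w i‖ ^ 2 = ∑ i, ∑ j, (inner ℂ (w i) (w j)).re := by
    rw [@norm_sq_eq_re_inner ℂ, sum_inner]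
    simp [inner_sum]
  have h2 : ∀ i j, (inner ℂ (w i) (w j)).re = b + if i = j then a - b else 0 := by
    intro i j
    by_cases hij : i = j
    · subst hij
      rw [← ha i, @norm_sq_eq_re_inner ℂ]
      simp
    · simp [hij, hb i j hij]
  simp_rw [h2, Finset.sum_add_distrib] at h
  simp at h
  nlinarith [sq_nonneg ‖∑ i, w i‖]

/-- `Φ` is antisymmetric. -/
def IsAntisym (Φ : NParticle d n) : Prop :=
  ∀ σ : Equiv.Perm (Fin n), perm d σ Φ = ((Equiv.Perm.sign σ : ℤ) : ℂ) • Φ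

theorem isAntisym_of_mem {Φ : NParticle d n} (h : Φ ∈ antisym d n) : IsAntisym Φ := by
  intro σ
  rw [antisym, Submodule.mem_iInf] at h
  have := h σ
  rw [LinearMap.mem_ker, LinearMap.sub_apply, sub_eq_zero] at this
  exact this

theorem sign_mul_self (σ : Equiv.Perm (Fin n)) :
    ((Equiv.Perm.sign σ : ℤ) : ℂ) * ((Equiv.Perm.sign σ : ℤ) : ℂ) = 1 := by
  rcases Int.units_eq_one_or (Equiv.Perm.sign σ) with h | h <;> simp [h]

theorem norm_sign (σ : Equiv.Perm (Fin n)) : ‖((Equiv.Perm.sign σ : ℤ) : ℂ)‖ = 1 := by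
  rcases Int.units_eq_one_or (Equiv.Perm.sign σ) with h | h <;> simp [h]

theorem conj_sign (σ : Equiv.Perm (Fin n)) :
    conj ((Equiv.Perm.sign σ : ℤ) : ℂ) = ((Equiv.Perm.sign σ : ℤ) : ℂ) := by
  rcases Int.units_eq_one_or (Equiv.Perm.sign σ) with h | h <;> simp [h]

/-- For `w` antisymmetric in all variables but the first one, `sgn(ρ) ⟨w, U_ρ w⟩` is the same for
all permutations `ρ` that move the first variable. -/
theorem sign_mul_inner_perm {w : NParticle d (n + 2)}
    (hw : ∀ σ : Equiv.Perm (Fin (n + 2)), σ 0 = 0 →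
      perm d σ w = ((Equiv.Perm.sign σ : ℤ) : ℂ) • w)
    {ρ : Equiv.Perm (Fin (n + 2))} (hρ : ρ 0 ≠ 0) :
    ((Equiv.Perm.sign ρ : ℤ) : ℂ) * inner ℂ w (perm d ρ w) = -inner ℂ w (flip d n w) := by
  set s : Equiv.Perm (Fin (n + 2)) := Equiv.swap 1 (ρ 0) with hs
  set t : Equiv.Perm (Fin (n + 2)) := Equiv.swap 0 1 with ht
  -- Double coset decomposition `ρ = s t r` with `s` and `r` fixing the first variable. Such
  -- permutations act on `w` by their signs, so only the transposition `t` of the first two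
  -- variables survives. If `ρ 0 = 1` then `s` is the identity.
  have hs0 : s 0 = 0 := Equiv.swap_apply_of_ne_of_ne (by simp) (Ne.symm hρ)
  set r : Equiv.Perm (Fin (n + 2)) := t * s * ρ with hr
  have hr0 : r 0 = 0 := by simp [hr, hs, ht]
  have hss : s * s = 1 := Equiv.swap_mul_self _ _
  have htt : t * t = 1 := Equiv.swap_mul_self _ _
  have hsi : s⁻¹ = s := Equiv.swap_inv _ _
  have e : ρ = s * t * r := by
    rw [hr, mul_assoc, ← mul_assoc t, ← mul_assoc t, htt, one_mul, ← mul_assoc, hss, one_mul]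
  have ht' : ((Equiv.Perm.sign t : ℤ) : ℂ) = -1 := by
    rw [ht, Equiv.Perm.sign_swap (by simp)]; simp
  have hsg : ((Equiv.Perm.sign ρ : ℤ) : ℂ)
      = -(((Equiv.Perm.sign s : ℤ) : ℂ) * ((Equiv.Perm.sign r : ℤ) : ℂ)) := by
    rw [e, Equiv.Perm.sign_mul, Equiv.Perm.sign_mul]
    push_cast
    rw [ht']
    ring
  have hin : inner ℂ w (perm d ρ w) = ((Equiv.Perm.sign s : ℤ) : ℂ) *
      (((Equiv.Perm.sign r : ℤ) : ℂ) * inner ℂ w (flip d n w)) := by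
    rw [e, perm_mul, perm_mul, hw r hr0, map_smul, map_smul, inner_smul_right, ← hsi,
      ← inner_perm_left, hw s hs0, inner_smul_left, conj_sign, hsi]
    rw [flip]
    ring
  rw [hin, hsg]
  linear_combination (-inner ℂ w (flip d n w)) * (((Equiv.Perm.sign s : ℤ) : ℂ) *
    ((Equiv.Perm.sign s : ℤ) : ℂ)) * sign_mul_self r - inner ℂ w (flip d n w) * sign_mul_self s

/-- For an operator `K` in one variable and `Φ` antisymmetric,
`m ‖K₁ Φ‖² + m (m - 1) Re ⟨K₁ Φ, K₂ Φ⟩ = ‖∑ᵢ Kᵢ Φ‖² ≥ 0`. -/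
theorem ActsAs.pair_nonneg {K : NParticle d (n + 2) →L[ℂ] NParticle d (n + 2)}
    {k : OneParticle d →L[ℂ] OneParticle d} (hK : ActsAs K k) {Φ : NParticle d (n + 2)}
    (hΦ : IsAntisym Φ) :
    0 ≤ ((n + 2 : ℕ) : ℝ) * ‖K Φ‖ ^ 2
      + ((n + 2 : ℕ) : ℝ) * (((n + 2 : ℕ) : ℝ) - 1) * (inner ℂ (K Φ) (second K Φ)).re := by
  set w := K Φ with hwdef
  have hw : ∀ σ : Equiv.Perm (Fin (n + 2)), σ 0 = 0 →
      perm d σ w = ((Equiv.Perm.sign σ : ℤ) : ℂ) • w := fun σ h0 => by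
    rw [hwdef, ← hK.perm_comm h0, hΦ, map_smul]
  have hflip : second K Φ = -flip d n w := by
    rw [second_apply, flip, hΦ, map_smul, map_smul, Equiv.Perm.sign_swap (by simp), hwdef]
    simp
  -- By antisymmetry of `Φ` the `i`-th vector is `KᵢΦ`: conjugating `K` with the transposition of
  -- `0` and `i` costs only the sign. For `i = 0` the transposition is the identity and the vector
  -- is `K Φ`.
  refine gram_nonneg (fun i => ((Equiv.Perm.sign (Equiv.swap 0 i) : ℤ) : ℂ) •
    perm d (Equiv.swap 0 i) w) (fun i => ?_) (fun i j hij => ?_)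
  · rw [norm_smul, norm_sign, one_mul, norm_perm]
  · rw [inner_smul_left, inner_smul_right, inner_perm_left, ← perm_mul, conj_sign, Equiv.swap_inv,
      ← mul_assoc, hflip, inner_neg_right, ← sign_mul_inner_perm hw (ρ := Equiv.swap 0 i *
        Equiv.swap 0 j), Equiv.Perm.sign_mul]
    · push_cast; rfl
    · rw [Equiv.Perm.mul_apply, Equiv.swap_apply_left]
      intro h
      rw [← Equiv.eq_symm_apply, Equiv.symm_swap, Equiv.swap_apply_left] at h
      exact hij h.symm

/-! ### The pair terms at fixed frequency -/

/-- Multiplication by `e^{iξ·(x₁ - x₂)}`. -/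
def pairPhase (n : ℕ) (ξ : Space d) : NParticle d (n + 2) →L[ℂ] NParticle d (n + 2) :=
  phase (n + 1) ξ ∘L second (phase (n + 1) (-ξ))

/-- The phase of the first variable is moved to the left entry, where it becomes `e_{-ξ}`. Operators
in different variables commute, so everything acting on the first variable collects on the left and
everything acting on the second on the right. -/
theorem inner_pairPhase {A A' B B' : NParticle d (n + 2) →L[ℂ] NParticle d (n + 2)}
    {a b b' : OneParticle d →L[ℂ] OneParticle d}
    (hA : ActsAs A a) (hB : ActsAs B b) (hB' : ActsAs B' b')
    (hAA' : ∀ Φ Ψ, inner ℂ (A' Φ) Ψ = inner ℂ Φ (A Ψ))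
    (hBB : ∀ Φ Ψ, inner ℂ (B Φ) Ψ = inner ℂ Φ (B' Ψ)) (ξ : Space d) (Φ : NParticle d (n + 2)) :
    inner ℂ (second B (A Φ)) (pairPhase n ξ (second B (A Φ)))
      = inner ℂ ((A' ∘L phase (n + 1) (-ξ) ∘L A) Φ)
        (second (B' ∘L phase (n + 1) (-ξ) ∘L B) Φ) := by
  have h1 : inner ℂ (second B (A Φ)) (pairPhase n ξ (second B (A Φ)))
      = inner ℂ (phase (n + 1) (-ξ) (second B (A Φ)))
        (second (phase (n + 1) (-ξ)) (second B (A Φ))) := by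
    rw [inner_phase_left, neg_neg]; rfl
  rw [h1, (ActsAs.phase (-ξ)).second_comm hB, inner_second_left hBB, ← second_comp_apply,
    ← second_comp_apply, ContinuousLinearMap.comp_assoc,
    ← hA.second_comm (hB'.comp ((ActsAs.phase (-ξ)).comp hB)), ← hAA']
  rfl

theorem re_inner_sub_sub {H : Type*} [NormedAddCommGroup H] [InnerProductSpace ℂ H]
    {a b x y : H} (h : inner ℂ b x = conj (inner ℂ a y)) :
    (inner ℂ (a - b) (x - y)).re = (inner ℂ a x + inner ℂ b y - 2 * inner ℂ a y).re := by
  rw [inner_sub_left, inner_sub_right, inner_sub_right, h]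
  simp only [sub_re, add_re, conj_re, mul_re, re_ofNat, im_ofNat, zero_mul, sub_zero]
  ring

/-- Exchanging the two variables, under which `Φ` only changes sign, turns one mixed term into the
complex conjugate of the other. Their real parts agree, which accounts for the coefficient `-2`. -/
theorem re_inner_sub_second (A B : NParticle d (n + 2) →L[ℂ] NParticle d (n + 2))
    {Φ : NParticle d (n + 2)} (hfl : flip d n Φ = -Φ) :
    (inner ℂ ((A - B) Φ) (second (A - B) Φ)).re
      = (inner ℂ (A Φ) (second A Φ) + inner ℂ (B Φ) (second B Φ)
        - 2 * inner ℂ (A Φ) (second B Φ)).re := by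
  have hsym : inner ℂ (B Φ) (second A Φ) = conj (inner ℂ (A Φ) (second B Φ)) := by
    rw [inner_conj_symm, second_apply, second_apply, hfl, map_neg, map_neg, map_neg, map_neg,
      inner_neg_left, inner_neg_right, inner_flip_left]
  have e : second (A - B) Φ = second A Φ - second B Φ := by
    rw [second_apply, second_apply, second_apply, sub_apply, map_sub]
  rw [e, sub_apply, re_inner_sub_sub hsym]

/-- The lower bound on the first three terms at fixed frequency. -/
theorem pair_terms_lower_bound {f : Fin M → OneParticle d} (hf : Orthonormal ℂ f) (ξ : Space d)
    {Φ : NParticle d (n + 2)} (hΦ : IsAntisym Φ) :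
    -(((n + 2 : ℕ) : ℝ) * ‖Φ‖ ^ 2) ≤ ((n + 2 : ℕ) : ℝ) * (((n + 2 : ℕ) : ℝ) - 1) *
      (inner ℂ (second (uOp (n + 1) f) (uOp (n + 1) f Φ))
          (pairPhase n ξ (second (uOp (n + 1) f) (uOp (n + 1) f Φ)))
        + inner ℂ (second (vOp (n + 1) f) (vOp (n + 1) f Φ))
          (pairPhase n ξ (second (vOp (n + 1) f) (vOp (n + 1) f Φ)))
        - 2 * inner ℂ (second (vOp (n + 1) f) (uOp (n + 1) f Φ))
          (pairPhase n ξ (second (vOp (n + 1) f) (uOp (n + 1) f Φ)))).re := by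
  -- The frequency is `-ξ` because `inner_pairPhase` produces `e_{-ξ}` in both entries.
  obtain ⟨k, hk⟩ := exists_actsAs_diffOp (n := n + 1) f (-ξ)
  have hpos := hk.pair_nonneg hΦ
  have hu := actsAs_uOp (n := n + 1) f
  have hv := actsAs_vOp (n := n + 1) f
  have hv' := actsAs_vAdj (n := n + 1) f
  rw [inner_pairPhase hu hu hu (inner_uOp_left f) (inner_uOp_left f),
    inner_pairPhase hv hv hv' (inner_vAdj_left f) (inner_vOp_left f),
    inner_pairPhase hu hv hv' (inner_uOp_left f) (inner_vOp_left f)]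
  have hfl : flip d n Φ = -Φ := by
    rw [flip, hΦ, Equiv.Perm.sign_swap (by simp)]; simp
  have hnorm := norm_diffOp_le hf (-ξ) Φ
  have hsq : ‖diffOp (n + 1) f (-ξ) Φ‖ ^ 2 ≤ ‖Φ‖ ^ 2 := by gcongr
  have h3 := mul_le_mul_of_nonneg_left hsq (Nat.cast_nonneg (α := ℝ) (n + 2))
  have hexp := re_inner_sub_second (uOp (n + 1) f ∘L phase (n + 1) (-ξ) ∘L uOp (n + 1) f)
    (vAdj (n + 1) f ∘L phase (n + 1) (-ξ) ∘L vOp (n + 1) f) hfl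
  rw [← hexp, ← diffOp]
  linarith

/-- The last term at fixed frequency is a square. -/
theorem cross_term_eq_norm_sq (f : Fin M → OneParticle d) (G : Fin M → NParticle d (n + 1))
    (ξ : Space d) :
    ∑ k, ∑ l, inner ℂ (flip d n (tensor (n + 1) (f l) (G k)))
        (pairPhase n ξ (tensor (n + 1) (f k) (G l)))
      = ((‖∑ k, contract n (expMul ξ (f k)) (G k)‖ ^ 2 : ℝ) : ℂ) := by
  have h : ((‖∑ k, contract n (expMul ξ (f k)) (G k)‖ ^ 2 : ℝ) : ℂ)
      = inner ℂ (∑ k, contract n (expMul ξ (f k)) (G k)) (∑ k, contract n (expMul ξ (f k)) (G k)) := by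
    rw [inner_self_eq_norm_sq_to_K]; simp
  rw [h, sum_inner]
  simp_rw [inner_sum]
  refine Finset.sum_congr rfl fun k _ => Finset.sum_congr rfl fun l _ => ?_
  -- One phase is absorbed by `f k` on the right; the other moves to the left and is absorbed by `f
  -- l`. The exchanged pairing then contracts `G k` with `e_ξ f k` and `G l` with `e_ξ f l`, so the
  -- double sum factorises.
  have h1 : pairPhase n ξ (tensor (n + 1) (f k) (G l))
      = second (phase (n + 1) (-ξ)) (tensor (n + 1) (expMul ξ (f k)) (G l)) := by
    rw [pairPhase, ContinuousLinearMap.comp_apply,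
      (ActsAs.phase ξ).second_comm (ActsAs.phase (-ξ)), ActsAs.phase]
  rw [h1, ← inner_second_left (inner_phase_left ξ), second_apply, flip_flip, ActsAs.phase,
    inner_flip_tensor_tensor]

/-! ### Splitting off the first two variables -/

theorem measurePreserving_cons_cons (d n : ℕ) :
    MeasurePreserving (fun q : (Space d × Space d) × (Fin n → Space d) =>
      (Fin.cons q.1.1 (Fin.cons q.1.2 q.2 : Fin (n + 1) → Space d) : Fin (n + 2) → Space d))
      ((volume.prod volume).prod volume) volume :=
  ((measurePreserving_cons d (n + 1)).comp
    ((MeasurePreserving.id volume).prod (measurePreserving_cons d n))).comp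
    (measurePreserving_prodAssoc volume volume volume)

theorem integrable_cons_cons {F : (Fin (n + 2) → Space d) → ℂ} (hF : Integrable F) :
    Integrable (fun q : (Space d × Space d) × (Fin n → Space d) =>
      F (Fin.cons q.1.1 (Fin.cons q.1.2 q.2 : Fin (n + 1) → Space d)))
      ((volume.prod volume).prod volume) :=
  (measurePreserving_cons_cons d n).integrable_comp_of_integrable hF

theorem integral_cons_cons {F : (Fin (n + 2) → Space d) → ℂ} (hF : Integrable F) :
    ∫ p : Space d × Space d, ∫ X : Fin n → Space d, F (Fin.cons p.1 (Fin.cons p.2 X : Fin (n + 1) → Space d))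
      = ∫ Z, F Z := by
  have h := integral_map (measurePreserving_cons_cons d n).aemeasurable
    ((measurePreserving_cons_cons d n).map_eq.symm ▸ hF.aestronglyMeasurable)
  rw [(measurePreserving_cons_cons d n).map_eq] at h
  rw [h]
  exact (integral_prod _ (integrable_cons_cons hF)).symm

theorem ae_cons_cons {P : (Fin (n + 2) → Space d) → Prop} (h : ∀ᵐ Z, P Z) :
    ∀ᵐ p : Space d × Space d, ∀ᵐ X : Fin n → Space d,
      P (Fin.cons p.1 (Fin.cons p.2 X : Fin (n + 1) → Space d)) :=
  Measure.ae_ae_of_ae_prod ((measurePreserving_cons_cons d n).quasiMeasurePreserving.ae h)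

theorem ae_sub {P : Space d → Prop} (h : ∀ᵐ x, P x) :
    ∀ᵐ p : Space d × Space d, P (p.1 - p.2) :=
  (quasiMeasurePreserving_sub volume volume).ae h


/-! ### The pair potential -/

theorem coeFn_flip (Φ : NParticle d (n + 2)) :
    flip d n Φ =ᵐ[volume] fun Z => Φ (fun i => Z (Equiv.swap 0 1 i)) :=
  coeFn_perm (Equiv.swap 0 1) Φ

theorem coeFn_second_phase (ξ : Space d) (F : NParticle d (n + 2)) :
    second (phase (n + 1) ξ) F =ᵐ[volume] fun Z => cexp (I * (inner ℝ ξ (Z 1) : ℝ)) * F Z := by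
  filter_upwards [coeFn_flip (phase (n + 1) ξ (flip d n F)),
    ae_perm (Equiv.swap 0 1) (coeFn_phase ξ (flip d n F)),
    ae_perm (Equiv.swap 0 1) (coeFn_flip F)] with Z h1 h2 h3
  rw [second_apply, h1, h2, h3]
  simp

theorem coeFn_pairPhase (ξ : Space d) (F : NParticle d (n + 2)) :
    pairPhase n ξ F =ᵐ[volume] fun Z => cexp (I * (inner ℝ ξ (Z 0 - Z 1) : ℝ)) * F Z := by
  filter_upwards [coeFn_phase ξ (second (phase (n + 1) (-ξ)) F), coeFn_second_phase (-ξ) F]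
    with Z h1 h2
  rw [pairPhase, ContinuousLinearMap.comp_apply, h1, h2, ← mul_assoc, ← exp_add, inner_sub_right,
    inner_neg_left]
  congr 2
  push_cast
  ring

theorem integrable_pair_fourier {Vhat : Space d → ℝ} (hV : Integrable Vhat)
    (F F' : NParticle d (n + 2)) :
    Integrable (fun q : Space d × (Fin (n + 2) → Space d) =>
      (Vhat q.1 : ℂ) * cexp (I * (inner ℝ q.1 (q.2 0 - q.2 1) : ℝ)) * (conj (F q.2) * F' q.2))
      (volume.prod volume) := by
  have h0 := hV.ofReal (𝕜 := ℂ) |>.mul_prod (integrable_conj_mul F F')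
  have h1 := h0.bdd_mul (c := 1)
    (f := fun q : Space d × (Fin (n + 2) → Space d) => cexp (I * (inner ℝ q.1 (q.2 0 - q.2 1) : ℝ)))
    (Continuous.aestronglyMeasurable (by fun_prop))
    (Filter.Eventually.of_forall fun q => (norm_cexp_I_mul _).le)
  refine h1.congr (Filter.Eventually.of_forall fun q => ?_)
  simp only [coe_algebraMap]
  ring

theorem integral_pair_fourier (F F' : NParticle d (n + 2)) (Vhat : Space d → ℝ) (ξ : Space d) :
    ∫ Z : Fin (n + 2) → Space d,
      (Vhat ξ : ℂ) * cexp (I * (inner ℝ ξ (Z 0 - Z 1) : ℝ)) * (conj (F Z) * F' Z)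
      = (Vhat ξ : ℂ) * inner ℂ F (pairPhase n ξ F') := by
  rw [inner_eq_integral, ← integral_const_mul]
  refine integral_congr_ae ?_
  filter_upwards [coeFn_pairPhase ξ F'] with Z h
  rw [h]
  ring

theorem integrable_mul_inner_pairPhase {Vhat : Space d → ℝ} (hV : Integrable Vhat)
    (F F' : NParticle d (n + 2)) :
    Integrable (fun ξ => (Vhat ξ : ℂ) * inner ℂ F (pairPhase n ξ F')) := by
  refine (integrable_pair_fourier hV F F').integral_prod_left.congr
    (Filter.Eventually.of_forall fun ξ => integral_pair_fourier F F' Vhat ξ)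

/-- Fubini in `ξ` and the particle variables: `Vhat` and `conj F · F'` are integrable and the phase
has modulus one. -/
theorem integral_pair_invFourier {Vhat : Space d → ℝ} (hV : Integrable Vhat)
    (F F' : NParticle d (n + 2)) :
    Integrable (fun Z : Fin (n + 2) → Space d =>
      invFourier Vhat (Z 0 - Z 1) * (conj (F Z) * F' Z)) ∧
    ∫ Z : Fin (n + 2) → Space d, invFourier Vhat (Z 0 - Z 1) * (conj (F Z) * F' Z)
      = ∫ ξ, (Vhat ξ : ℂ) * inner ℂ F (pairPhase n ξ F') := by
  have h := integrable_pair_fourier hV F F'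
  have e : ∀ Z : Fin (n + 2) → Space d, invFourier Vhat (Z 0 - Z 1) * (conj (F Z) * F' Z)
      = ∫ ξ, (Vhat ξ : ℂ) * cexp (I * (inner ℝ ξ (Z 0 - Z 1) : ℝ)) * (conj (F Z) * F' Z) :=
    fun Z => by rw [integral_mul_const, invFourier]
  simp_rw [e, ← integral_pair_fourier]
  exact ⟨h.integral_prod_right, (integral_integral_swap h).symm⟩

/-- The overlap `∫ conj F(x, y, X) F'(x, y, X) dX` at `p = (x, y)`. -/
def pairSlice (F F' : NParticle d (n + 2)) (p : Space d × Space d) : ℂ :=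
  ∫ X : Fin n → Space d, conj (F (Fin.cons p.1 (Fin.cons p.2 X : Fin (n + 1) → Space d))) *
    F' (Fin.cons p.1 (Fin.cons p.2 X : Fin (n + 1) → Space d))

theorem pairSlice_self (F : NParticle d (n + 2)) (p : Space d × Space d) :
    pairSlice F F p = ((∫ X : Fin n → Space d,
      ‖F (Fin.cons p.1 (Fin.cons p.2 X : Fin (n + 1) → Space d))‖ ^ 2 : ℝ) : ℂ) := by
  rw [pairSlice, ← integral_complex_ofReal]
  simp_rw [conj_mul', ofReal_pow]

/-- This is where `V` is replaced by its Fourier representation: the map `(x, y) ↦ x - y` pulls null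
sets back to null sets, so the almost everywhere identity for `V` suffices. -/
theorem integrable_and_integral_pairSlice {V Vhat : Space d → ℝ} (hV : IsRegularPotential V Vhat)
    (F F' : NParticle d (n + 2)) :
    Integrable (fun p : Space d × Space d => (V (p.1 - p.2) : ℂ) * pairSlice F F' p) ∧
    ∫ p : Space d × Space d, (V (p.1 - p.2) : ℂ) * pairSlice F F' p
      = ∫ ξ, (Vhat ξ : ℂ) * inner ℂ F (pairPhase n ξ F') := by
  obtain ⟨h1, h2⟩ := integral_pair_invFourier hV.integrable_vhat F F'
  have e : (fun p : Space d × Space d => (V (p.1 - p.2) : ℂ) * pairSlice F F' p)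
      =ᵐ[volume] fun p => ∫ X : Fin n → Space d, invFourier Vhat (p.1 - p.2) *
        (conj (F (Fin.cons p.1 (Fin.cons p.2 X : Fin (n + 1) → Space d))) *
          F' (Fin.cons p.1 (Fin.cons p.2 X : Fin (n + 1) → Space d))) := by
    filter_upwards [ae_sub hV.ae_eq_invFourier] with p hp
    rw [integral_const_mul, pairSlice, hp]
  constructor
  · exact (integrable_cons_cons h1).integral_prod_left.congr e.symm
  · rw [integral_congr_ae e, ← h2, ← integral_cons_cons h1]
    rfl

theorem norm_pairPhase_apply (ξ : Space d) (F : NParticle d (n + 2)) : ‖pairPhase n ξ F‖ = ‖F‖ := by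
  rw [pairPhase, ContinuousLinearMap.comp_apply, norm_phase_apply, second_apply, norm_flip,
    norm_phase_apply, norm_flip]

/-! ### The operators `α_x` and `β_x` in terms of `u` and `v` -/

theorem alpha_eq_sum (f : Fin M → OneParticle d) (x : Space d) (φ : (Fin (n + 1) → Space d) → ℂ)
    (X : Fin n → Space d)
    (hφ : ∀ k, Integrable fun y => conj (f k y) * φ (Fin.cons y X)) :
    alpha f x φ X = (Real.sqrt (n + 1) : ℂ) *
      (φ (Fin.cons x X) - ∑ k, f k x * ∫ y, conj (f k y) * φ (Fin.cons y X)) := by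
  have h : ∀ y, conj (gammaKernel f y x) * φ (Fin.cons y X)
      = ∑ k, f k x * (conj (f k y) * φ (Fin.cons y X)) := fun y => by
    rw [gammaKernel, map_sum, Finset.sum_mul]
    refine Finset.sum_congr rfl fun k _ => ?_
    rw [map_mul, conj_conj]
    ring
  simp_rw [alpha, annAt, ann, h]
  rw [integral_finsetSum _ fun k _ => (hφ k).const_mul _, mul_sub]
  simp_rw [integral_const_mul]

theorem beta_eq_sum (f : Fin M → OneParticle d) (x : Space d) (φ : (Fin (n + 1) → Space d) → ℂ)
    (X : Fin n → Space d)
    (hφ : ∀ k, Integrable fun y => conj (f k y) * φ (Fin.cons y X)) :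
    beta f x φ X = (Real.sqrt (n + 1) : ℂ) *
      ∑ k, conj (f k x) * ∫ y, conj (f k y) * φ (Fin.cons y X) := by
  have h : ∀ y, conj (conj (vKernel f y x)) * φ (Fin.cons y X)
      = ∑ k, conj (f k x) * (conj (f k y) * φ (Fin.cons y X)) := fun y => by
    rw [vKernel, conj_conj, Finset.sum_mul]
    refine Finset.sum_congr rfl fun k _ => ?_
    ring
  simp_rw [beta, ann, h]
  rw [integral_finsetSum _ fun k _ => (hφ k).const_mul _]
  simp_rw [integral_const_mul]

theorem coeFn_finset_sum {α ι : Type*} [MeasureSpace α] (s : Finset ι)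
    (F : ι → Lp ℂ 2 (volume : Measure α)) :
    (∑ i ∈ s, F i : Lp ℂ 2 (volume : Measure α)) =ᵐ[volume] fun x => ∑ i ∈ s, F i x := by
  classical
  induction s using Finset.induction_on with
  | empty =>
    simp only [Finset.sum_empty]
    exact Lp.coeFn_zero ℂ 2 (volume : Measure α)
  | insert a s ha ih =>
    rw [Finset.sum_insert ha]
    filter_upwards [Lp.coeFn_add (F a) (∑ i ∈ s, F i), ih] with x h1 h2
    rw [h1, Pi.add_apply, h2, Finset.sum_insert ha]

theorem coeFn_uOp (f : Fin M → OneParticle d) (Φ : NParticle d (n + 1)) :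
    uOp n f Φ =ᵐ[volume] fun Z => Φ Z - ∑ k, f k (Z 0) * contract n (f k) Φ (Fin.tail Z) := by
  rw [uOp, bodyOp_apply, one_smul]
  have h1 : ∀ᵐ Z, ∀ k, tensor n (-f k) (contract n (f k) Φ) Z
      = (-f k : OneParticle d) (Z 0) * contract n (f k) Φ (Fin.tail Z) :=
    ae_all_iff.2 fun k => coeFn_tensor _ _
  have h2 : ∀ᵐ Z : Fin (n + 1) → Space d, ∀ k, (-f k : OneParticle d) (Z 0) = -(f k (Z 0)) :=
    ae_all_iff.2 fun k => ae_zero_var (Lp.coeFn_neg (f k))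
  filter_upwards [Lp.coeFn_add Φ (∑ k, tensor n (-f k) (contract n (f k) Φ)),
    coeFn_finset_sum Finset.univ fun k => tensor n (-f k) (contract n (f k) Φ), h1, h2]
    with Z h3 h4 h5 h6
  rw [h3, Pi.add_apply, h4, sub_eq_add_neg, ← Finset.sum_neg_distrib]
  simp_rw [h5, h6, neg_mul]

theorem coeFn_vOp (f : Fin M → OneParticle d) (Φ : NParticle d (n + 1)) :
    vOp n f Φ =ᵐ[volume] fun Z => ∑ k, conj (f k (Z 0)) * contract n (f k) Φ (Fin.tail Z) := by
  rw [vOp, bodyOp_apply, zero_smul, zero_add]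
  have h1 : ∀ᵐ Z, ∀ k, tensor n (star (f k)) (contract n (f k) Φ) Z
      = (star (f k) : OneParticle d) (Z 0) * contract n (f k) Φ (Fin.tail Z) :=
    ae_all_iff.2 fun k => coeFn_tensor _ _
  have h2 : ∀ᵐ Z : Fin (n + 1) → Space d, ∀ k,
      (star (f k) : OneParticle d) (Z 0) = conj (f k (Z 0)) :=
    ae_all_iff.2 fun k => ae_zero_var (Lp.coeFn_star (f k))
  filter_upwards [coeFn_finset_sum Finset.univ fun k => tensor n (star (f k)) (contract n (f k) Φ),
    h1, h2] with Z h4 h5 h6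
  rw [h4]
  simp_rw [h5, h6]

theorem integrable_conj_mul_of_memLp (g : OneParticle d) {φ : Space d → ℂ} (hφ : MemLp φ 2) :
    Integrable fun y => conj (g y) * φ y := by
  refine (integrable_conj_mul g (hφ.toLp φ)).congr ?_
  filter_upwards [hφ.coeFn_toLp] with y hy
  rw [hy]

theorem ae_integrable_and_contract (f : Fin M → OneParticle d) (Φ : NParticle d (n + 1)) :
    ∀ᵐ X : Fin n → Space d, ∀ k, Integrable (fun y => conj (f k y) * Φ (Fin.cons y X)) ∧
      ∫ y, conj (f k y) * Φ (Fin.cons y X) = contract n (f k) Φ X := by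
  refine ae_all_iff.2 fun k => ?_
  filter_upwards [ae_memLp_slice Φ, coeFn_contract (f k) Φ] with X h1 h2
  exact ⟨integrable_conj_mul_of_memLp _ h1, h2.symm⟩

/-- For almost all remaining variables the slice of `Φ` is square integrable, so the integral
defining `a(γ_x)` splits into the contractions that make up `u = 1 - γ`. -/
theorem ae_alpha (f : Fin M → OneParticle d) (Φ : NParticle d (n + 1)) :
    ∀ᵐ Z : Fin (n + 1) → Space d,
      alpha f (Z 0) Φ (Fin.tail Z) = (Real.sqrt (n + 1) : ℂ) * uOp n f Φ Z := by
  filter_upwards [coeFn_uOp f Φ, ae_tail (ae_integrable_and_contract f Φ)] with Z h1 h2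
  rw [alpha_eq_sum f _ _ _ fun k => (h2 k).1, h1, Fin.cons_self_tail]
  simp_rw [fun k => (h2 k).2]

theorem ae_beta (f : Fin M → OneParticle d) (Φ : NParticle d (n + 1)) :
    ∀ᵐ Z : Fin (n + 1) → Space d,
      beta f (Z 0) Φ (Fin.tail Z) = (Real.sqrt (n + 1) : ℂ) * vOp n f Φ Z := by
  filter_upwards [coeFn_vOp f Φ, ae_tail (ae_integrable_and_contract f Φ)] with Z h1 h2
  rw [beta_eq_sum f _ _ _ fun k => (h2 k).1, h1]
  simp_rw [fun k => (h2 k).2]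

theorem cons_comp_swap (Y : Fin (n + 1) → Space d) (y : Space d) :
    (fun i => (Fin.cons y Y : Fin (n + 2) → Space d) (Equiv.swap 0 1 i))
      = Fin.cons (Y 0) (Fin.cons y (Fin.tail Y) : Fin (n + 1) → Space d) := by
  funext i
  refine Fin.cases ?_ (fun j => ?_) i
  · simp only [Equiv.swap_apply_left, Fin.cons_zero]
    rw [← Fin.succ_zero_eq_one, Fin.cons_succ]
  · refine Fin.cases ?_ (fun l => ?_) j
    · simp
    · have h1 : Fin.succ (Fin.succ l) ≠ (1 : Fin (n + 2)) := fun h =>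
        Fin.succ_ne_zero l (Fin.succ_injective _ h)
      rw [Equiv.swap_apply_of_ne_of_ne (Fin.succ_ne_zero _) h1]
      simp [Fin.tail]

theorem tail_comp_swap (Z : Fin (n + 2) → Space d) :
    Fin.tail (fun i => Z (Equiv.swap 0 1 i))
      = (Fin.cons (Z 0) (Fin.tail (Fin.tail Z)) : Fin (n + 1) → Space d) := by
  have h := cons_comp_swap (Fin.tail Z) (Z 0)
  rw [Fin.cons_self_tail] at h
  rw [h, Fin.tail_cons]

theorem coeFn_second_uOp (f : Fin M → OneParticle d) (G : NParticle d (n + 2)) :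
    second (uOp (n + 1) f) G =ᵐ[volume] fun Z => G Z - ∑ k, f k (Z 1) *
      contract (n + 1) (f k) (flip d n G) (Fin.cons (Z 0) (Fin.tail (Fin.tail Z))) := by
  filter_upwards [coeFn_flip (uOp (n + 1) f (flip d n G)),
    ae_perm (Equiv.swap 0 1) (coeFn_uOp f (flip d n G)),
    ae_perm (Equiv.swap 0 1) (coeFn_flip G)] with Z h1 h2 h3
  rw [second_apply, h1, h2, h3, tail_comp_swap]
  simp only [Equiv.swap_apply_self, Equiv.swap_apply_left]

theorem coeFn_second_vOp (f : Fin M → OneParticle d) (G : NParticle d (n + 2)) :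
    second (vOp (n + 1) f) G =ᵐ[volume] fun Z => ∑ k, conj (f k (Z 1)) *
      contract (n + 1) (f k) (flip d n G) (Fin.cons (Z 0) (Fin.tail (Fin.tail Z))) := by
  filter_upwards [coeFn_flip (vOp (n + 1) f (flip d n G)),
    ae_perm (Equiv.swap 0 1) (coeFn_vOp f (flip d n G))] with Z h1 h2
  rw [second_apply, h1, h2, tail_comp_swap]
  simp only [Equiv.swap_apply_left]

section Family

variable (f : Fin M → OneParticle d) {φ : Space d → (Fin (n + 1) → Space d) → ℂ} {s : ℂ}
  {G : NParticle d (n + 2)}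

/-- Contraction of the second variable of a family of functions that represents `s • G`. -/
theorem ae_integrable_and_contract_family
    (h : ∀ᵐ Z : Fin (n + 2) → Space d, φ (Z 0) (Fin.tail Z) = s * G Z) :
    ∀ᵐ Y : Fin (n + 1) → Space d, ∀ k,
      Integrable (fun y => conj (f k y) * φ (Y 0) (Fin.cons y (Fin.tail Y))) ∧
      ∫ y, conj (f k y) * φ (Y 0) (Fin.cons y (Fin.tail Y))
        = s * contract (n + 1) (f k) (flip d n G) Y := by
  filter_upwards [ae_integrable_and_contract f (flip d n G),
    ae_ae_cons' (ae_perm (Equiv.swap 0 1) h), ae_ae_cons' (coeFn_flip G)] with Y h1 h2 h3 k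
  have e : (fun y => conj (f k y) * φ (Y 0) (Fin.cons y (Fin.tail Y))) =ᵐ[volume]
      fun y => s * (conj (f k y) * flip d n G (Fin.cons y Y)) := by
    filter_upwards [h2, h3] with y hy2 hy3
    rw [cons_comp_swap] at hy2 hy3
    rw [congrFun (cons_comp_swap Y y) 0, Fin.cons_zero, Fin.tail_cons] at hy2
    rw [hy2, hy3]
    ring
  refine ⟨((h1 k).1.const_mul s).congr e.symm, ?_⟩
  rw [integral_congr_ae e, integral_const_mul, (h1 k).2]

/-- The identity in `n + 1` variables is pulled back to `n + 2` variables, the new variable `Z 1`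
being a dummy; exchanging it with `Z 0` puts it in the place that is dropped. -/
theorem ae_integrable_and_contract_family_second
    (h : ∀ᵐ Z : Fin (n + 2) → Space d, φ (Z 0) (Fin.tail Z) = s * G Z) :
    ∀ᵐ Z : Fin (n + 2) → Space d, ∀ k,
      Integrable (fun y => conj (f k y) * φ (Z 0) (Fin.cons y (Fin.tail (Fin.tail Z)))) ∧
      ∫ y, conj (f k y) * φ (Z 0) (Fin.cons y (Fin.tail (Fin.tail Z)))
        = s * contract (n + 1) (f k) (flip d n G)
          (Fin.cons (Z 0) (Fin.tail (Fin.tail Z))) := by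
  filter_upwards [ae_perm (Equiv.swap 0 1) (ae_tail (ae_integrable_and_contract_family f h))]
    with Z h4
  rw [tail_comp_swap] at h4
  simpa only [Fin.cons_zero, Fin.tail_cons] using h4

/-- After one annihilation operator there is a family of functions indexed by `x`, known only to
represent `s • G` jointly almost everywhere. The second operator is therefore computed for such
families and acts as `u` in the second variable. -/
theorem ae_alpha_family (h : ∀ᵐ Z : Fin (n + 2) → Space d, φ (Z 0) (Fin.tail Z) = s * G Z) :
    ∀ᵐ Z : Fin (n + 2) → Space d, alpha f (Z 1) (φ (Z 0)) (Fin.tail (Fin.tail Z))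
      = (Real.sqrt (n + 1) : ℂ) * s * second (uOp (n + 1) f) G Z := by
  filter_upwards [h, coeFn_second_uOp f G, ae_integrable_and_contract_family_second f h]
    with Z h0 h1 h4
  rw [alpha_eq_sum f _ _ _ fun k => (h4 k).1, h1]
  have e : (Fin.cons (Z 1) (Fin.tail (Fin.tail Z)) : Fin (n + 1) → Space d) = Fin.tail Z :=
    Fin.cons_self_tail (Fin.tail Z)
  have hs : ∑ k, f k (Z 1) * ∫ y, conj (f k y) * φ (Z 0) (Fin.cons y (Fin.tail (Fin.tail Z)))
      = s * ∑ k, f k (Z 1) * contract (n + 1) (f k) (flip d n G)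
          (Fin.cons (Z 0) (Fin.tail (Fin.tail Z))) := by
    rw [Finset.mul_sum]
    refine Finset.sum_congr rfl fun k _ => ?_
    rw [(h4 k).2, mul_left_comm]
  rw [e, h0, hs]
  ring

theorem ae_beta_family (h : ∀ᵐ Z : Fin (n + 2) → Space d, φ (Z 0) (Fin.tail Z) = s * G Z) :
    ∀ᵐ Z : Fin (n + 2) → Space d, beta f (Z 1) (φ (Z 0)) (Fin.tail (Fin.tail Z))
      = (Real.sqrt (n + 1) : ℂ) * s * second (vOp (n + 1) f) G Z := by
  filter_upwards [coeFn_second_vOp f G, ae_integrable_and_contract_family_second f h] with Z h1 h4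
  rw [beta_eq_sum f _ _ _ fun k => (h4 k).1, h1, mul_assoc, Finset.mul_sum (a := s)]
  congr 1
  refine Finset.sum_congr rfl fun k _ => ?_
  rw [(h4 k).2, mul_left_comm]

/-- The diagonal `x = y` is a null set, so this is not a restriction of `ae_beta_family`. It makes
sense because `β` integrates out the second variable before its index is set equal to `Y 0`. -/
theorem ae_beta_family_diag (h : ∀ᵐ Z : Fin (n + 2) → Space d, φ (Z 0) (Fin.tail Z) = s * G Z) :
    ∀ᵐ Y : Fin (n + 1) → Space d, beta f (Y 0) (φ (Y 0)) (Fin.tail Y)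
      = (Real.sqrt (n + 1) : ℂ) * s *
        ∑ k, conj (f k (Y 0)) * contract (n + 1) (f k) (flip d n G) Y := by
  filter_upwards [ae_integrable_and_contract_family f h] with Y h4
  rw [beta_eq_sum f _ _ _ fun k => (h4 k).1]
  simp_rw [fun k => (h4 k).2]
  rw [mul_assoc, Finset.mul_sum (a := s)]
  simp_rw [mul_left_comm]

end Family

/-! ### The form on a sector in terms of frequencies -/

/-- The product of the normalisations of two annihilation operators on `n + 2` particles. -/
def pairNorm (n : ℕ) : ℂ := (Real.sqrt (n + 1) : ℂ) * (Real.sqrt ((n + 1 : ℕ) + 1) : ℂ)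

theorem conj_pairNorm_mul_self (n : ℕ) :
    conj (pairNorm n) * pairNorm n = (((n + 2 : ℕ) : ℝ) * (((n + 2 : ℕ) : ℝ) - 1) : ℝ) := by
  rw [pairNorm, map_mul, conj_ofReal, conj_ofReal, mul_mul_mul_comm, ← ofReal_mul, ← ofReal_mul,
    Real.mul_self_sqrt (by positivity), Real.mul_self_sqrt (by positivity), ← ofReal_mul]
  congr 1
  push_cast
  ring

theorem ae_braket_self {A : Space d → Space d → (Fin n → Space d) → ℂ} {F : NParticle d (n + 2)}
    (h : ∀ᵐ Z : Fin (n + 2) → Space d,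
      A (Z 0) (Z 1) (Fin.tail (Fin.tail Z)) = pairNorm n * F Z) :
    ∀ᵐ p : Space d × Space d, braket (A p.1 p.2) (A p.1 p.2)
      = (((n + 2 : ℕ) : ℝ) * (((n + 2 : ℕ) : ℝ) - 1) : ℝ) * pairSlice F F p := by
  filter_upwards [ae_cons_cons h] with p hp
  rw [← conj_pairNorm_mul_self, braket, pairSlice, ← integral_const_mul]
  refine integral_congr_ae ?_
  filter_upwards [hp] with X hX
  have e : A p.1 p.2 X
      = pairNorm n * F (Fin.cons p.1 (Fin.cons p.2 X : Fin (n + 1) → Space d)) := hX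
  rw [e, map_mul]
  ring

theorem ae_alpha_two (f : Fin M → OneParticle d) (Φ : NParticle d (n + 2)) :
    ∀ᵐ Z : Fin (n + 2) → Space d, alpha f (Z 0) Φ (Fin.tail Z)
      = (Real.sqrt ((n + 1 : ℕ) + 1) : ℂ) * uOp (n + 1) f Φ Z :=
  ae_alpha f Φ

theorem ae_beta_two (f : Fin M → OneParticle d) (Φ : NParticle d (n + 2)) :
    ∀ᵐ Z : Fin (n + 2) → Space d, beta f (Z 0) Φ (Fin.tail Z)
      = (Real.sqrt ((n + 1 : ℕ) + 1) : ℂ) * vOp (n + 1) f Φ Z :=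
  ae_beta f Φ

theorem ae_braket_alpha_alpha (f : Fin M → OneParticle d) (Φ : NParticle d (n + 2)) :
    ∀ᵐ p : Space d × Space d,
      braket (alpha f p.2 (alpha f p.1 Φ)) (alpha f p.2 (alpha f p.1 Φ))
        = (((n + 2 : ℕ) : ℝ) * (((n + 2 : ℕ) : ℝ) - 1) : ℝ) *
          pairSlice (second (uOp (n + 1) f) (uOp (n + 1) f Φ))
            (second (uOp (n + 1) f) (uOp (n + 1) f Φ)) p :=
  ae_braket_self (A := fun x y => alpha f y (alpha f x Φ))
    (ae_alpha_family f (φ := fun x => alpha f x Φ) (ae_alpha_two f Φ))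

theorem ae_braket_beta_beta (f : Fin M → OneParticle d) (Φ : NParticle d (n + 2)) :
    ∀ᵐ p : Space d × Space d,
      braket (beta f p.2 (beta f p.1 Φ)) (beta f p.2 (beta f p.1 Φ))
        = (((n + 2 : ℕ) : ℝ) * (((n + 2 : ℕ) : ℝ) - 1) : ℝ) *
          pairSlice (second (vOp (n + 1) f) (vOp (n + 1) f Φ))
            (second (vOp (n + 1) f) (vOp (n + 1) f Φ)) p :=
  ae_braket_self (A := fun x y => beta f y (beta f x Φ))
    (ae_beta_family f (φ := fun x => beta f x Φ) (ae_beta_two f Φ))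

theorem ae_braket_beta_alpha (f : Fin M → OneParticle d) (Φ : NParticle d (n + 2)) :
    ∀ᵐ p : Space d × Space d,
      braket (beta f p.2 (alpha f p.1 Φ)) (beta f p.2 (alpha f p.1 Φ))
        = (((n + 2 : ℕ) : ℝ) * (((n + 2 : ℕ) : ℝ) - 1) : ℝ) *
          pairSlice (second (vOp (n + 1) f) (uOp (n + 1) f Φ))
            (second (vOp (n + 1) f) (uOp (n + 1) f Φ)) p :=
  ae_braket_self (A := fun x y => beta f y (alpha f x Φ))
    (ae_beta_family f (φ := fun x => alpha f x Φ) (ae_alpha_two f Φ))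

/-- The vector `a(f_k) u₂ Φ`, up to normalisation. -/
def crossVec (f : Fin M → OneParticle d) (Φ : NParticle d (n + 2)) (k : Fin M) :
    NParticle d (n + 1) :=
  contract (n + 1) (f k) (flip d n (uOp (n + 1) f Φ))

theorem ae_integrable_pairSlice (F F' : NParticle d (n + 2)) :
    ∀ᵐ p : Space d × Space d, Integrable fun X : Fin n → Space d =>
      conj (F (Fin.cons p.1 (Fin.cons p.2 X : Fin (n + 1) → Space d))) *
        F' (Fin.cons p.1 (Fin.cons p.2 X : Fin (n + 1) → Space d)) :=
  (integrable_cons_cons (integrable_conj_mul F F')).prod_right_ae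

theorem coeFn_flip_tensor (g : OneParticle d) (G : NParticle d (n + 1)) :
    flip d n (tensor (n + 1) g G) =ᵐ[volume] fun Z =>
      g (Z 1) * G (Fin.cons (Z 0) (Fin.tail (Fin.tail Z))) := by
  filter_upwards [coeFn_flip (tensor (n + 1) g G), ae_perm (Equiv.swap 0 1) (coeFn_tensor g G)]
    with Z h1 h2
  rw [h1, h2, tail_comp_swap]
  simp only [Equiv.swap_apply_left]

theorem ae_braket_cross (f : Fin M → OneParticle d) (Φ : NParticle d (n + 2)) :
    ∀ᵐ p : Space d × Space d,
      braket (beta f p.1 (alpha f p.1 Φ)) (beta f p.2 (alpha f p.2 Φ))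
        = (((n + 2 : ℕ) : ℝ) * (((n + 2 : ℕ) : ℝ) - 1) : ℝ) *
          ∑ k, ∑ l, pairSlice (flip d n (tensor (n + 1) (f l) (crossVec f Φ k)))
            (tensor (n + 1) (f k) (crossVec f Φ l)) p := by
  have hd : ∀ᵐ Y : Fin (n + 1) → Space d, beta f (Y 0) (alpha f (Y 0) Φ) (Fin.tail Y)
      = pairNorm n * ∑ k, conj (f k (Y 0)) * crossVec f Φ k Y :=
    ae_beta_family_diag f (φ := fun x => alpha f x Φ) (ae_alpha_two f Φ)
  have h1 : ∀ᵐ Z : Fin (n + 2) → Space d, ∀ k l,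
      tensor (n + 1) (f k) (crossVec f Φ l) Z = f k (Z 0) * crossVec f Φ l (Fin.tail Z) :=
    ae_all_iff.2 fun k => ae_all_iff.2 fun l => coeFn_tensor _ _
  have h2 : ∀ᵐ Z : Fin (n + 2) → Space d, ∀ k l,
      flip d n (tensor (n + 1) (f l) (crossVec f Φ k)) Z
        = f l (Z 1) * crossVec f Φ k (Fin.cons (Z 0) (Fin.tail (Fin.tail Z))) :=
    ae_all_iff.2 fun k => ae_all_iff.2 fun l => coeFn_flip_tensor _ _
  have hi : ∀ᵐ p : Space d × Space d, ∀ k l, Integrable fun X : Fin n → Space d =>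
      conj (flip d n (tensor (n + 1) (f l) (crossVec f Φ k))
        (Fin.cons p.1 (Fin.cons p.2 X : Fin (n + 1) → Space d))) *
      tensor (n + 1) (f k) (crossVec f Φ l)
        (Fin.cons p.1 (Fin.cons p.2 X : Fin (n + 1) → Space d)) :=
    ae_all_iff.2 fun k => ae_all_iff.2 fun l => ae_integrable_pairSlice _ _
  have hd2 : ∀ᵐ p : Space d × Space d, ∀ᵐ X : Fin n → Space d,
      beta f p.1 (alpha f p.1 Φ) X
        = pairNorm n * ∑ k, conj (f k p.1) * crossVec f Φ k (Fin.cons p.1 X) := by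
    refine Measure.quasiMeasurePreserving_fst.ae (p := fun x => ∀ᵐ X : Fin n → Space d,
      beta f x (alpha f x Φ) X
        = pairNorm n * ∑ k, conj (f k x) * crossVec f Φ k (Fin.cons x X)) ?_
    simpa only [Fin.cons_zero, Fin.tail_cons] using ae_ae_cons hd
  have hd3 : ∀ᵐ p : Space d × Space d, ∀ᵐ X : Fin n → Space d,
      beta f p.2 (alpha f p.2 Φ) X
        = pairNorm n * ∑ k, conj (f k p.2) * crossVec f Φ k (Fin.cons p.2 X) := by
    refine Measure.quasiMeasurePreserving_snd.ae (p := fun x => ∀ᵐ X : Fin n → Space d,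
      beta f x (alpha f x Φ) X
        = pairNorm n * ∑ k, conj (f k x) * crossVec f Φ k (Fin.cons x X)) ?_
    simpa only [Fin.cons_zero, Fin.tail_cons] using ae_ae_cons hd
  filter_upwards [hd2, hd3, ae_cons_cons h1, ae_cons_cons h2, hi] with p e1 e2 e3 e4 e5
  simp_rw [pairSlice, ← conj_pairNorm_mul_self, braket]
  -- The finite sums are brought under the integral over `X`, where the product of the two single
  -- sums over `k` and `l` can be expanded.
  rw [Finset.sum_congr rfl fun k _ => (integral_finsetSum _ fun l _ => e5 k l).symm,
    ← integral_finsetSum _ fun k _ => integrable_finsetSum _ fun l _ => e5 k l,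
    ← integral_const_mul]
  refine integral_congr_ae ?_
  filter_upwards [e1, e2, e3, e4] with X x1 x2 x3 x4
  have hz : (Fin.cons p.1 (Fin.cons p.2 X : Fin (n + 1) → Space d) : Fin (n + 2) → Space d) 1
    = p.2 := rfl
  rw [x1, x2]
  simp only [x3, x4, hz, Fin.cons_zero, Fin.tail_cons, map_mul, map_sum, conj_conj]
  rw [mul_mul_mul_comm, Finset.sum_mul_sum]
  congr 1
  refine Finset.sum_congr rfl fun k _ => Finset.sum_congr rfl fun l _ => ?_
  ring

/-- `∫ Vhat(ξ) ⟨F, e^{iξ·(x₁ - x₂)} F'⟩ dξ`, which is `⟨F, V(x₁ - x₂) F'⟩`. -/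
def pairForm (Vhat : Space d → ℝ) (F F' : NParticle d (n + 2)) : ℂ :=
  ∫ ξ, (Vhat ξ : ℂ) * inner ℂ F (pairPhase n ξ F')

theorem ae_diagIntegrand (V : Space d → ℝ) (f : Fin M → OneParticle d) (Φ : NParticle d (n + 2)) :
    diagIntegrand V f Φ =ᵐ[volume] fun p =>
      (((n + 2 : ℕ) : ℝ) * (((n + 2 : ℕ) : ℝ) - 1) : ℝ) *
        ((V (p.1 - p.2) : ℂ) * pairSlice (second (uOp (n + 1) f) (uOp (n + 1) f Φ))
            (second (uOp (n + 1) f) (uOp (n + 1) f Φ)) p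
          + (V (p.1 - p.2) : ℂ) * pairSlice (second (vOp (n + 1) f) (vOp (n + 1) f Φ))
            (second (vOp (n + 1) f) (vOp (n + 1) f Φ)) p
          - 2 * ((V (p.1 - p.2) : ℂ) * pairSlice (second (vOp (n + 1) f) (uOp (n + 1) f Φ))
            (second (vOp (n + 1) f) (uOp (n + 1) f Φ)) p)
          + 2 * ∑ k, ∑ l, (V (p.1 - p.2) : ℂ) *
            pairSlice (flip d n (tensor (n + 1) (f l) (crossVec f Φ k)))
              (tensor (n + 1) (f k) (crossVec f Φ l)) p) := by
  filter_upwards [ae_braket_alpha_alpha f Φ, ae_braket_beta_beta f Φ, ae_braket_beta_alpha f Φ,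
    ae_braket_cross f Φ] with p h1 h2 h3 h4
  rw [diagIntegrand, h1, h2, h3, h4]
  simp_rw [← Finset.mul_sum]
  ring

theorem integrable_and_diagSector_eq {V Vhat : Space d → ℝ} (hV : IsRegularPotential V Vhat)
    (f : Fin M → OneParticle d) (Φ : NParticle d (n + 2)) :
    Integrable (diagIntegrand V f Φ) ∧
    diagSector V f Φ = (((n + 2 : ℕ) : ℝ) * (((n + 2 : ℕ) : ℝ) - 1) : ℝ) *
      (pairForm Vhat (second (uOp (n + 1) f) (uOp (n + 1) f Φ))
          (second (uOp (n + 1) f) (uOp (n + 1) f Φ))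
        + pairForm Vhat (second (vOp (n + 1) f) (vOp (n + 1) f Φ))
          (second (vOp (n + 1) f) (vOp (n + 1) f Φ))
        - 2 * pairForm Vhat (second (vOp (n + 1) f) (uOp (n + 1) f Φ))
          (second (vOp (n + 1) f) (uOp (n + 1) f Φ))
        + 2 * ∑ k, ∑ l, pairForm Vhat (flip d n (tensor (n + 1) (f l) (crossVec f Φ k)))
            (tensor (n + 1) (f k) (crossVec f Φ l))) := by
  have hI := fun F F' : NParticle d (n + 2) => (integrable_and_integral_pairSlice hV F F').1
  have hJ := fun F F' : NParticle d (n + 2) => (integrable_and_integral_pairSlice hV F F').2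
  have hs := integrable_finsetSum (μ := (volume : Measure (Space d × Space d))) Finset.univ
    fun k _ => integrable_finsetSum Finset.univ fun l _ =>
      hI (flip d n (tensor (n + 1) (f l) (crossVec f Φ k))) (tensor (n + 1) (f k) (crossVec f Φ l))
  have h12 := (hI (second (uOp (n + 1) f) (uOp (n + 1) f Φ))
    (second (uOp (n + 1) f) (uOp (n + 1) f Φ))).add
    (hI (second (vOp (n + 1) f) (vOp (n + 1) f Φ)) (second (vOp (n + 1) f) (vOp (n + 1) f Φ)))
  have h3 := (hI (second (vOp (n + 1) f) (uOp (n + 1) f Φ))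
    (second (vOp (n + 1) f) (uOp (n + 1) f Φ))).const_mul 2
  have h123 := h12.sub h3
  refine ⟨((h123.add (hs.const_mul 2)).const_mul _).congr (ae_diagIntegrand V f Φ).symm, ?_⟩
  rw [diagSector, integral_congr_ae (ae_diagIntegrand V f Φ), integral_const_mul]
  congr 1
  refine (integral_add h123 (hs.const_mul 2)).trans ?_
  refine congrArg₂ _ ((integral_sub h12 h3).trans (congrArg₂ _
    ((integral_add (hI _ _) (hI _ _)).trans (congrArg₂ _ (hJ _ _) (hJ _ _)))
    ((integral_const_mul _ _).trans (congrArg _ (hJ _ _))))) ?_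
  rw [integral_const_mul, integral_finsetSum _ fun k _ => integrable_finsetSum _ fun l _ => hI _ _]
  congr 1
  refine Finset.sum_congr rfl fun k _ => ?_
  rw [integral_finsetSum _ fun l _ => hI _ _]
  exact Finset.sum_congr rfl fun l _ => hJ _ _

/-! ### Boundedness, reality and lower bound of the form on a sector -/

theorem norm_pairForm_le {V Vhat : Space d → ℝ} (hV : IsRegularPotential V Vhat)
    {F F' : NParticle d (n + 2)} {r : ℝ} (hF : ‖F‖ ≤ r) (hF' : ‖F'‖ ≤ r) :
    ‖pairForm Vhat F F'‖ ≤ (∫ ξ, Vhat ξ) * r ^ 2 := by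
  rw [← integral_mul_const]
  refine norm_integral_le_of_norm_le (hV.integrable_vhat.mul_const _) ?_
  filter_upwards [hV.nonneg] with ξ h
  rw [norm_mul, norm_real, Real.norm_of_nonneg h]
  gcongr
  refine (norm_inner_le_norm _ _).trans ?_
  rw [norm_pairPhase_apply, sq]
  exact mul_le_mul hF hF' (norm_nonneg _) ((norm_nonneg _).trans hF)

/-- Reality is visible in position space: `V` is real and the slice is an integral of `‖F‖²`. -/
theorem pairForm_self_im {V Vhat : Space d → ℝ} (hV : IsRegularPotential V Vhat)
    (F : NParticle d (n + 2)) : (pairForm Vhat F F).im = 0 := by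
  rw [pairForm, ← (integrable_and_integral_pairSlice hV F F).2]
  simp_rw [pairSlice_self, ← ofReal_mul]
  rw [integral_complex_ofReal, ofReal_im]

theorem cross_eq_ofReal {Vhat : Space d → ℝ} (hV : Integrable Vhat)
    (f : Fin M → OneParticle d) (G : Fin M → NParticle d (n + 1)) :
    ∑ k, ∑ l, pairForm Vhat (flip d n (tensor (n + 1) (f l) (G k))) (tensor (n + 1) (f k) (G l))
      = ((∫ ξ, Vhat ξ * ‖∑ k, contract n (expMul ξ (f k)) (G k)‖ ^ 2 : ℝ) : ℂ) := by
  have hI := fun F F' : NParticle d (n + 2) => integrable_mul_inner_pairPhase hV F F'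
  rw [← integral_complex_ofReal]
  simp_rw [ofReal_mul, ← cross_term_eq_norm_sq, Finset.mul_sum]
  rw [integral_finsetSum _ fun k _ => integrable_finsetSum _ fun l _ => hI _ _]
  refine Finset.sum_congr rfl fun k _ => ?_
  rw [integral_finsetSum _ fun l _ => hI _ _]
  rfl

theorem norm_second_le {K : NParticle d (n + 2) →L[ℂ] NParticle d (n + 2)}
    (hK : ∀ Φ, ‖K Φ‖ ≤ ‖Φ‖) {Φ : NParticle d (n + 2)} {r : ℝ} (hΦ : ‖Φ‖ ≤ r) :
    ‖second K Φ‖ ≤ r := by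
  rw [second_apply, norm_flip]
  exact (hK _).trans ((norm_flip _).le.trans hΦ)

theorem norm_crossVec_le {f : Fin M → OneParticle d} (hf : Orthonormal ℂ f)
    (Φ : NParticle d (n + 2)) (k : Fin M) : ‖crossVec f Φ k‖ ≤ ‖Φ‖ := by
  refine (norm_contract_le _ _).trans ?_
  rw [hf.1 k, one_mul, norm_flip]
  exact norm_uOp_le hf Φ

/-- This crude bound serves only to sum over sectors on the domain of `𝒩`. The `4` comes from the
coefficients `1 + 1 + 2` of the first three terms, the `2 M²` from the double sum in the last one.
-/
theorem norm_diagSector_le {V Vhat : Space d → ℝ} (hV : IsRegularPotential V Vhat)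
    {f : Fin M → OneParticle d} (hf : Orthonormal ℂ f) (Φ : NParticle d (n + 2)) :
    ‖diagSector V f Φ‖ ≤ (4 + 2 * (M : ℝ) ^ 2) * (∫ ξ, Vhat ξ) *
      (((n + 2 : ℕ) : ℝ) ^ 2 * ‖Φ‖ ^ 2) := by
  have hu := norm_uOp_le (n := n + 1) hf
  have hv := norm_vOp_le (n := n + 1) hf
  set B := (∫ ξ, Vhat ξ) * ‖Φ‖ ^ 2 with hB
  have b1 := norm_pairForm_le hV (norm_second_le hu (hu Φ)) (norm_second_le hu (hu Φ))
  have b2 := norm_pairForm_le hV (norm_second_le hv (hv Φ)) (norm_second_le hv (hv Φ))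
  have b3 := norm_pairForm_le hV (norm_second_le hv (hu Φ)) (norm_second_le hv (hu Φ))
  have b4 : ∀ k l, ‖pairForm Vhat (flip d n (tensor (n + 1) (f l) (crossVec f Φ k)))
      (tensor (n + 1) (f k) (crossVec f Φ l))‖ ≤ B := fun k l => by
    refine norm_pairForm_le hV ?_ ?_
    · rw [norm_flip, norm_tensor_apply, hf.1, one_mul]
      exact norm_crossVec_le hf Φ k
    · rw [norm_tensor_apply, hf.1, one_mul]
      exact norm_crossVec_le hf Φ l
  have b5 : ‖∑ k, ∑ l, pairForm Vhat (flip d n (tensor (n + 1) (f l) (crossVec f Φ k)))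
      (tensor (n + 1) (f k) (crossVec f Φ l))‖ ≤ (M : ℝ) ^ 2 * B := by
    refine (norm_sum_le_of_le _ fun k _ => norm_sum_le_of_le _ fun l _ => b4 k l).trans ?_
    simp [sq, mul_assoc]
  have hB0 : 0 ≤ B := mul_nonneg (integral_nonneg_of_ae hV.nonneg) (sq_nonneg _)
  rw [(integrable_and_diagSector_eq hV f Φ).2, norm_mul, norm_real, Real.norm_of_nonneg (by
    push_cast; nlinarith [Nat.cast_nonneg (α := ℝ) n])]
  have hm : ((n + 2 : ℕ) : ℝ) * (((n + 2 : ℕ) : ℝ) - 1) ≤ ((n + 2 : ℕ) : ℝ) ^ 2 := by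
    nlinarith [Nat.cast_nonneg (α := ℝ) (n + 2)]
  have hsum : ∀ a b c e : ℂ, ‖a‖ ≤ B → ‖b‖ ≤ B → ‖c‖ ≤ B → ‖e‖ ≤ (M : ℝ) ^ 2 * B →
      ‖a + b - 2 * c + 2 * e‖ ≤ (4 + 2 * (M : ℝ) ^ 2) * B := by
    intro a b c e ha hb hc he
    have h2 : ‖(2 : ℂ)‖ = 2 := by simp
    have t1 := norm_add_le (a + b - 2 * c) (2 * e)
    have t2 := norm_sub_le (a + b) (2 * c)
    have t3 := norm_add_le a b
    rw [norm_mul, h2] at t1 t2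
    linarith
  refine (mul_le_mul hm (hsum _ _ _ _ b1 b2 b3 b5) (norm_nonneg _) (by positivity)).trans
    (le_of_eq ?_)
  rw [hB]
  ring

theorem two_mul_re (z : ℂ) : (2 * z).re = 2 * z.re := by simp

theorem two_mul_im (z : ℂ) : (2 * z).im = 2 * z.im := by simp

theorem diagSector_im {V Vhat : Space d → ℝ} (hV : IsRegularPotential V Vhat)
    (f : Fin M → OneParticle d) (Φ : NParticle d (n + 2)) : (diagSector V f Φ).im = 0 := by
  rw [(integrable_and_diagSector_eq hV f Φ).2, cross_eq_ofReal hV.integrable_vhat, im_ofReal_mul,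
    add_im, sub_im, add_im, pairForm_self_im hV, pairForm_self_im hV, two_mul_im,
    two_mul_im, pairForm_self_im hV, ofReal_im]
  simp

/-- The cross term is nonnegative, and the fixed-frequency bound for the other three is integrated
against `Vhat ≥ 0`. -/
theorem diagSector_re_ge {V Vhat : Space d → ℝ} (hV : IsRegularPotential V Vhat)
    {f : Fin M → OneParticle d} (hf : Orthonormal ℂ f) {Φ : NParticle d (n + 2)}
    (hΦ : IsAntisym Φ) :
    -((∫ ξ, Vhat ξ) * (((n + 2 : ℕ) : ℝ) * ‖Φ‖ ^ 2)) ≤ (diagSector V f Φ).re := by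
  have hI := fun F F' : NParticle d (n + 2) =>
    integrable_mul_inner_pairPhase hV.integrable_vhat F F'
  have hm : (0 : ℝ) ≤ ((n + 2 : ℕ) : ℝ) * (((n + 2 : ℕ) : ℝ) - 1) := by
    push_cast; nlinarith [Nat.cast_nonneg (α := ℝ) n]
  rw [(integrable_and_diagSector_eq hV f Φ).2, cross_eq_ofReal hV.integrable_vhat, re_ofReal_mul,
    add_re, two_mul_re, ofReal_re]
  have hcross : 0 ≤ ∫ ξ, Vhat ξ * ‖∑ k, contract n (expMul ξ (f k)) (crossVec f Φ k)‖ ^ 2 := by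
    refine integral_nonneg_of_ae ?_
    filter_upwards [hV.nonneg] with ξ h
    exact mul_nonneg h (sq_nonneg _)
  set F1 := second (uOp (n + 1) f) (uOp (n + 1) f Φ) with hF1
  set F2 := second (vOp (n + 1) f) (vOp (n + 1) f Φ) with hF2
  set F3 := second (vOp (n + 1) f) (uOp (n + 1) f Φ) with hF3
  have h123 := ((hI F1 F1).add (hI F2 F2)).sub ((hI F3 F3).const_mul 2)
  have e : pairForm Vhat F1 F1 + pairForm Vhat F2 F2 - 2 * pairForm Vhat F3 F3
      = ∫ ξ, (Vhat ξ : ℂ) * (inner ℂ F1 (pairPhase n ξ F1) + inner ℂ F2 (pairPhase n ξ F2)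
        - 2 * inner ℂ F3 (pairPhase n ξ F3)) := by
    have h1 := (integral_sub ((hI F1 F1).add (hI F2 F2)) ((hI F3 F3).const_mul 2)).trans
      (congrArg₂ (· - ·) (integral_add (hI F1 F1) (hI F2 F2)) (integral_const_mul 2 _))
    refine h1.symm.trans (integral_congr_ae (Filter.Eventually.of_forall fun ξ => ?_))
    simp only [Pi.add_apply]
    ring
  have hint : Integrable (fun ξ => (Vhat ξ : ℂ) * (inner ℂ F1 (pairPhase n ξ F1)
      + inner ℂ F2 (pairPhase n ξ F2) - 2 * inner ℂ F3 (pairPhase n ξ F3))) := by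
    refine h123.congr (Filter.Eventually.of_forall fun ξ => ?_)
    simp only [Pi.add_apply, Pi.sub_apply]
    ring
  have hlow : -((∫ ξ, Vhat ξ) * (((n + 2 : ℕ) : ℝ) * ‖Φ‖ ^ 2)) ≤
      ((n + 2 : ℕ) : ℝ) * (((n + 2 : ℕ) : ℝ) - 1) *
        (pairForm Vhat F1 F1 + pairForm Vhat F2 F2 - 2 * pairForm Vhat F3 F3).re := by
    -- The real part goes under the `ξ`-integral, so that the bound can be applied pointwise in `ξ`.
    rw [e, ← reCLM_apply, ← reCLM.integral_comp_comm hint, ← integral_const_mul,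
      ← integral_mul_const, ← integral_neg]
    refine integral_mono_ae (hV.integrable_vhat.mul_const _).neg
      ((reCLM.integrable_comp hint).const_mul _) ?_
    filter_upwards [hV.nonneg] with ξ h
    have hb := mul_le_mul_of_nonneg_left (pair_terms_lower_bound hf ξ hΦ) h
    simp only [reCLM_apply, re_ofReal_mul]
    rw [← hF1, ← hF2, ← hF3] at hb
    linarith
  rw [mul_add]
  have := mul_nonneg hm (mul_nonneg two_pos.le hcross)
  linarith

end FermiDiag

end

/-! The commutator bound is not used: each fixed-frequency form is bounded below by `-𝒩` because
the last term of `𝓛₄^diag` is a square, and `1 ≤ 20 C₀ N ħ` absorbs this error. -/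

open FermiDiag in
theorem lemma4p4 (d N M : ℕ) (hd : 1 ≤ d) (hN : 1 ≤ N)
    (V Vhat : Space d → ℝ) (hV : IsRegularPotential V Vhat)
    (f : Fin M → OneParticle d) (hf : Orthonormal ℂ f)
    (C₀ : ℝ) (hC₀ : 0 < C₀) (hC₀N : 1 ≤ 20 * C₀ * (N * hbar d N))
    (hcomm : ∀ ξ : Space d,
      ‖expMul ξ ∘L densityOp f - densityOp f ∘L expMul ξ‖ ≤ C₀ * ‖ξ‖ * N * hbar d N)
    (Ψ : FockSpace d) (hΨ : InNumberDomain Ψ) :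
    (∀ n : ℕ, Integrable (diagIntegrand V f (wave Ψ (n + 2)))) ∧
    (Summable fun n : ℕ => diagSector V f (wave Ψ (n + 2))) ∧
    (diagForm V f Ψ).im = 0 ∧
    -(20 * C₀ * potentialNorm Vhat * hbar d N * (numberForm Ψ + ‖Ψ‖ ^ 2))
      ≤ (N : ℝ)⁻¹ * (diagForm V f Ψ).re := by
  have hsq : Summable fun n : ℕ => ((n + 2 : ℕ) : ℝ) ^ 2 * ‖Ψ (n + 2)‖ ^ 2 :=
    (summable_nat_add_iff (f := fun n : ℕ => (n : ℝ) ^ 2 * ‖Ψ n‖ ^ 2) 2).2 hΨ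
  -- For natural numbers `n ≤ n²`, so the domain condition also makes `⟨Ψ, 𝒩 Ψ⟩` a convergent
  -- series.
  have hlin : Summable fun n : ℕ => (n : ℝ) * ‖Ψ n‖ ^ 2 := by
    refine Summable.of_nonneg_of_le (fun n => by positivity) (fun n => ?_) hΨ
    gcongr
    rcases Nat.eq_zero_or_pos n with h | h
    · simp [h]
    · have : (1 : ℝ) ≤ n := by exact_mod_cast h
      nlinarith
  have hlin2 : Summable fun n : ℕ => ((n + 2 : ℕ) : ℝ) * ‖Ψ (n + 2)‖ ^ 2 :=
    (summable_nat_add_iff (f := fun n : ℕ => (n : ℝ) * ‖Ψ n‖ ^ 2) 2).2 hlin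
  have hsum : Summable fun n : ℕ => diagSector V f (wave Ψ (n + 2)) :=
    Summable.of_norm_bounded (hsq.mul_left _)
      fun n => norm_diagSector_le hV hf (Ψ (n + 2) : NParticle d (n + 2))
  have hV0 : 0 ≤ ∫ ξ, Vhat ξ := integral_nonneg_of_ae hV.nonneg
  refine ⟨fun n => (integrable_and_diagSector_eq hV f (Ψ (n + 2) : NParticle d (n + 2))).1, hsum,
    ?_, ?_⟩
  · rw [diagForm, im_tsum hsum]
    exact (tsum_congr fun n => diagSector_im hV f (Ψ (n + 2) : NParticle d (n + 2))).trans tsum_zero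
  -- The form starts at two particles; the omitted sectors `0` and `1` contribute nonnegatively to
  -- `⟨Ψ, 𝒩 Ψ⟩`.
  · have hnum : ∑' n : ℕ, ((n + 2 : ℕ) : ℝ) * ‖Ψ (n + 2)‖ ^ 2 ≤ numberForm Ψ := by
      rw [numberForm, ← hlin.sum_add_tsum_nat_add 2]
      exact le_add_of_nonneg_left (Finset.sum_nonneg fun n _ => by positivity)
    have hnum0 : 0 ≤ numberForm Ψ := tsum_nonneg fun n => by positivity
    have hre : -((∫ ξ, Vhat ξ) * numberForm Ψ) ≤ (diagForm V f Ψ).re := by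
      rw [diagForm, re_tsum hsum]
      refine (neg_le_neg (mul_le_mul_of_nonneg_left hnum hV0)).trans ?_
      rw [← tsum_mul_left, ← tsum_neg]
      refine Summable.tsum_le_tsum (fun n => ?_) (hlin2.mul_left _).neg
        (hasSum_re hsum.hasSum).summable
      exact diagSector_re_ge hV hf (isAntisym_of_mem (Ψ (n + 2)).2)
    have hN0 : (0 : ℝ) < N := by exact_mod_cast hN
    have hle := hV.integral_vhat_le
    have hP : 0 ≤ potentialNorm Vhat := hV0.trans hle
    -- The error is enlarged to `‖V‖ (⟨Ψ, 𝒩 Ψ⟩ + ‖Ψ‖²)` and multiplied by `20 C₀ N ħ ≥ 1`; division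
    -- by `N` then leaves the factor `20 C₀ ħ`.
    have h1 : (∫ ξ, Vhat ξ) * numberForm Ψ
        ≤ (20 * C₀ * (N * hbar d N)) * (potentialNorm Vhat * (numberForm Ψ + ‖Ψ‖ ^ 2)) := by
      have a1 : (∫ ξ, Vhat ξ) * numberForm Ψ ≤ potentialNorm Vhat * (numberForm Ψ + ‖Ψ‖ ^ 2) :=
        mul_le_mul hle (le_add_of_nonneg_right (sq_nonneg _)) hnum0 hP
      exact a1.trans (le_mul_of_one_le_left (mul_nonneg hP (add_nonneg hnum0 (sq_nonneg _))) hC₀N)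
    rw [inv_mul_eq_div, le_div_iff₀ hN0]
    linarith
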